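/- A $\Pi_m\Sigma_s$ polynomial in variables $x_1,\dots,x_n$ ($m,s\ge 1$) is a product $p=f_1\cdots f_m$ of $m$ clauses, where each clause $f_i$ is a sum of at least one and at most $s$ terms and each term is a single variable (repetitions allowed). The sum-product expansion of $p$ is the list of all $s_1\cdots s_m$ products $\pi_1\cdots\pi_m$ with $\pi_i$ one of the $s_i$ terms of $f_i$, like monomials not being collected; $p$ is the sum of this list over any coefficient ring. A monomial is multilinear if every variable occurs in it with exponent at most $1$. Theorem. There is an algorithm that, given $n$ and a $\Pi_m\Sigma_s$ polynomial $p$ in $n$ variables by its clauses, tests in time $O(ms\sqrt{m+n})$ whether the sum-product expansion of $p$ contains a multilinear monomial. The constant in the $O$ is absolute. Here time is the number of unit-cost steps of a random access machine with registers and arrays, initially zero outside the input, whose elementary operations are constants, copying, addition, truncated subtraction, indirect load and store, and comparisons; the algorithm is one fixed program. Its words need only have $\log_2 N+O(1)$ bits, where $N$ is $n$ plus the total number of terms of the clauses: there is an absolute constant $K$ such that the program works within the time bound, without overflow, for every word length $w$ with $2^w\ge KN$. The input consists of $m$, $n$, the numbers of terms of the clauses, and the list of the variable indices in the clauses, clause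 after clause. Moreover, the sum-product expansion of $p$ contains a multilinear monomial if and only if $p$, as an element of $\mathbb{Z}[x_1,\dots,x_n]$, has a multilinear monomial with nonzero coefficient. -/

import Mathlib

/-! ## Product-of-sums polynomials -/

/-- A `Π_m Σ_s` polynomial in the variables `x_0, …, x_{n-1}`, given by its representation as a
product of `m` clauses. Each clause is a sum of at least one and at most `s` terms, and each term
is a single variable; a variable may be repeated. -/
structure PiSigma (m s n : ℕ) where
  clause : Fin m → List (Fin n)
  one_le_length : ∀ i, 1 ≤ (clause i).length
  length_le : ∀ i, (clause i).length ≤ s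

/-- A monomial, given by its exponents, is multilinear if no exponent exceeds one. -/
def IsMultilinear {n : ℕ} (d : Fin n →₀ ℕ) : Prop :=
  ∀ v, d v ≤ 1

namespace PiSigma

variable {m s n : ℕ}

/-- The polynomial represented by `p`, with coefficients in `P`. -/
noncomputable def toMvPolynomial (p : PiSigma m s n) (P : Type) [CommSemiring P] :
    MvPolynomial (Fin n) P :=
  ∏ i, ((p.clause i).map MvPolynomial.X).sum

/-- The sum-product expansion of `p`: the list of all monomials `π_1 ⋯ π_m`, where `π_i` is a term
of the `i`-th clause, one for each choice of a term in every clause (like monomials are not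
collected; the order of the list is immaterial, so it is a multiset). -/
noncomputable def expansion (p : PiSigma m s n) : Multiset (Fin n →₀ ℕ) :=
  (Finset.univ : Finset (∀ i : Fin m, Fin (p.clause i).length)).val.map
    fun c => ∑ i, Finsupp.single ((p.clause i).get (c i)) 1

/-- Whatever the coefficients are, `p` is the sum of the monomials in its expansion. -/
theorem toMvPolynomial_eq_sum_expansion (p : PiSigma m s n) (P : Type) [CommSemiring P] :
    p.toMvPolynomial P = (p.expansion.map fun d => MvPolynomial.monomial d (1 : P)).sum := by
  have h : ∀ i, ((p.clause i).map (MvPolynomial.X (R := P))).sum =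
      ∑ j : Fin (p.clause i).length, MvPolynomial.X ((p.clause i).get j) := by
    intro i
    conv_lhs => rw [← List.ofFn_get (p.clause i), List.map_ofFn, List.sum_ofFn]
    rfl
  unfold toMvPolynomial expansion
  simp_rw [h]
  rw [Finset.prod_univ_sum, Multiset.map_map, Fintype.piFinset_univ]
  change _ = ∑ c, _
  refine Finset.sum_congr rfl fun c _ => ?_
  simp only [Function.comp, MvPolynomial.X]
  exact (MvPolynomial.monomial_sum_one _ _).symm

/-- `p` has a multilinear monomial in its sum-product expansion. -/
def HasMultilinearMonomial (p : PiSigma m s n) : Prop :=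
  ∃ d ∈ p.expansion, IsMultilinear d

/-- The total number of terms in the clauses of `p`. -/
def numTerms (p : PiSigma m s n) : ℕ :=
  ∑ i, (p.clause i).length

end PiSigma

/-! ## A word RAM -/

namespace WordRAM

/-- Tests compare two registers. -/
inductive Test where
  | lt (a b : ℕ)
  | eq (a b : ℕ)

/-- Programs of a random access machine, in structured form. A program mentions finitely many
registers and finitely many arrays, both named by natural numbers. -/
inductive Cmd where
  | skip
  /-- `r := k` for a literal `k` -/
  | const (r k : ℕ)
  /-- `r := a` -/
  | copy (r a : ℕ)
  /-- `r := a + b` -/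
  | add (r a b : ℕ)
  /-- `r := max (a - b) 0` -/
  | sub (r a b : ℕ)
  /-- `r := A[i]` -/
  | load (r A i : ℕ)
  /-- `A[i] := a` -/
  | store (A i a : ℕ)
  | seq (c₁ c₂ : Cmd)
  | cond (b : Test) (c₁ c₂ : Cmd)
  | loop (b : Test) (c : Cmd)

/-- The contents of the registers and of the arrays. -/
structure State where
  reg : ℕ → ℕ
  arr : ℕ → ℕ → ℕ

namespace State

def setReg (σ : State) (r v : ℕ) : State :=
  { σ with reg := Function.update σ.reg r v }

def setArr (σ : State) (A i v : ℕ) : State :=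
  { σ with arr := Function.update σ.arr A (Function.update (σ.arr A) i v) }

end State

def Test.Holds (σ : State) : Test → Prop
  | .lt a b => σ.reg a < σ.reg b
  | .eq a b => σ.reg a = σ.reg b

/-- `Exec w c σ t τ`: on a machine with words of `w` bits, program `c` started in state `σ` halts
in state `τ` after `t` steps. Every elementary command and every evaluation of a test is one step.
A literal or a sum that does not fit into a word blocks the machine. -/
inductive Exec (w : ℕ) : Cmd → State → ℕ → State → Prop where
  | skip (σ : State) : Exec w .skip σ 1 σ
  | const (σ : State) (r k : ℕ) (h : k < 2 ^ w) : Exec w (.const r k) σ 1 (σ.setReg r k)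
  | copy (σ : State) (r a : ℕ) : Exec w (.copy r a) σ 1 (σ.setReg r (σ.reg a))
  | add (σ : State) (r a b : ℕ) (h : σ.reg a + σ.reg b < 2 ^ w) :
      Exec w (.add r a b) σ 1 (σ.setReg r (σ.reg a + σ.reg b))
  | sub (σ : State) (r a b : ℕ) : Exec w (.sub r a b) σ 1 (σ.setReg r (σ.reg a - σ.reg b))
  | load (σ : State) (r A i : ℕ) : Exec w (.load r A i) σ 1 (σ.setReg r (σ.arr A (σ.reg i)))
  | store (σ : State) (A i a : ℕ) :
      Exec w (.store A i a) σ 1 (σ.setArr A (σ.reg i) (σ.reg a))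
  | seq {c₁ c₂ : Cmd} {σ τ υ : State} {t₁ t₂ : ℕ} (h₁ : Exec w c₁ σ t₁ τ)
      (h₂ : Exec w c₂ τ t₂ υ) : Exec w (.seq c₁ c₂) σ (t₁ + t₂) υ
  | condTrue {b : Test} {c₁ c₂ : Cmd} {σ τ : State} {t : ℕ} (hb : b.Holds σ)
      (h : Exec w c₁ σ t τ) : Exec w (.cond b c₁ c₂) σ (1 + t) τ
  | condFalse {b : Test} {c₁ c₂ : Cmd} {σ τ : State} {t : ℕ} (hb : ¬ b.Holds σ)
      (h : Exec w c₂ σ t τ) : Exec w (.cond b c₁ c₂) σ (1 + t) τ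
  | loopTrue {b : Test} {c : Cmd} {σ τ υ : State} {t₁ t₂ : ℕ} (hb : b.Holds σ)
      (h₁ : Exec w c σ t₁ τ) (h₂ : Exec w (.loop b c) τ t₂ υ) :
      Exec w (.loop b c) σ (1 + t₁ + t₂) υ
  | loopFalse {b : Test} {c : Cmd} {σ : State} (hb : ¬ b.Holds σ) : Exec w (.loop b c) σ 1 σ

/-- The machine is deterministic. -/
theorem Exec.deterministic {w : ℕ} {c : Cmd} {σ τ₁ τ₂ : State} {t₁ t₂ : ℕ}
    (h₁ : Exec w c σ t₁ τ₁) (h₂ : Exec w c σ t₂ τ₂) : t₁ = t₂ ∧ τ₁ = τ₂ := by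
  induction h₁ generalizing t₂ τ₂ with
  | seq _ _ ih₁ ih₂ =>
    cases h₂ with
    | seq g₁ g₂ =>
      obtain ⟨rfl, rfl⟩ := ih₁ g₁
      obtain ⟨rfl, rfl⟩ := ih₂ g₂
      exact ⟨rfl, rfl⟩
  | condTrue hb _ ih =>
    cases h₂ with
    | condTrue _ g => obtain ⟨rfl, rfl⟩ := ih g; exact ⟨rfl, rfl⟩
    | condFalse gb _ => exact absurd hb gb
  | condFalse hb _ ih =>
    cases h₂ with
    | condTrue gb _ => exact absurd gb hb
    | condFalse _ g => obtain ⟨rfl, rfl⟩ := ih g; exact ⟨rfl, rfl⟩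
  | loopTrue hb _ _ ih₁ ih₂ =>
    cases h₂ with
    | loopTrue _ g₁ g₂ =>
      obtain ⟨rfl, rfl⟩ := ih₁ g₁
      obtain ⟨rfl, rfl⟩ := ih₂ g₂
      exact ⟨rfl, rfl⟩
    | loopFalse gb => exact absurd hb gb
  | loopFalse hb =>
    cases h₂ with
    | loopTrue gb _ _ => exact absurd gb hb
    | loopFalse _ => exact ⟨rfl, rfl⟩
  | _ => cases h₂; exact ⟨rfl, rfl⟩

end WordRAM

/-- The initial state on input `p`: register `0` holds `m`, register `1` holds `n`, array `0` holds
the numbers of terms of the `m` clauses, array `1` holds the indices of the variables in all the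
clauses, written one clause after the other. Everything else is zero. -/
def PiSigma.input {m s n : ℕ} (p : PiSigma m s n) : WordRAM.State where
  reg r := [m, n].getD r 0
  arr A i :=
    match A with
    | 0 => (List.ofFn fun k => (p.clause k).length).getD i 0
    | 1 => (((List.ofFn p.clause).flatten).map Fin.val).getD i 0
    | _ => 0

/-!
A choice of one term from every clause gives a multilinear monomial if and only if the chosen
variables are distinct. So the question is whether the clauses have a system of distinct
representatives, that is, whether the bipartite graph of clauses and variables has a matching that
saturates the clauses. Let `E` be the number of terms. As `E ≤ m s`, it suffices to answer it in
`O(E √m)` steps. Loops over all variables are not allowed, since `n` may be large, but none is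
needed: the arrays are zero at the start, and visits are marked by the number of the search.

A matching is built in two stages. The first one is an auction with `L = ⌈√m⌉` price levels. Every
variable has a price and every clause a level, both zero at the start. A clause that owns nothing
runs through its terms for a variable whose price equals its level, takes it, possibly from another
clause, and raises its price by one. At the end of its list it goes one level higher, and at level
`L` it is given up. As prices never fall, a clause runs through its list once per level, so the
auction takes `O(E L)` steps (`Incidence.auctionPot`). The prices are a dual solution of the
matching problem: if the clauses have distinct representatives, then at most `m / L ≤ L` clauses
are given up (`Incidence.AuctionInv.mul_le`).

In the second stage, at most `L` clauses are left, and for each of them a depth-first search for an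
augmenting path takes `O(E)` steps. The search moves the matching along with it: a clause takes an
unvisited variable at once, and the former owner continues the search; if that fails, the former
owner regains the variable. A search that fails at its root leaves a set of visited clauses with too
few variables, contrary to Hall's condition (`Incidence.SearchInv.not_saturable`).

For the second assertion, the coefficients in `ℤ` count the occurrences of a monomial in the
expansion, so nothing cancels.
-/

/-! ### Families of clauses and matchings -/

/-- A family of `m` clauses, stored as one list of variables: the terms of clause `u` are those at
the positions `start u ≤ e < start (u + 1)`. -/
structure Incidence where
  m : ℕ
  start : ℕ → ℕ
  var : ℕ → ℕ
  start_zero : start 0 = 0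
  start_le : ∀ u < m, start u ≤ start (u + 1)

namespace Incidence

/-- The variable `v` is a term of clause `u`. -/
def Adj (G : Incidence) (u v : ℕ) : Prop :=
  ∃ e, G.start u ≤ e ∧ e < G.start (u + 1) ∧ G.var e = v

/-- The clauses have a system of distinct representatives. -/
def Saturable (G : Incidence) : Prop :=
  ∃ g : ℕ → ℕ, (∀ u < G.m, G.Adj u (g u)) ∧ Set.InjOn g (Set.Iio G.m)

theorem sum_deg (G : Incidence) :
    ∑ u ∈ Finset.range G.m, (G.start (u + 1) - G.start u) = G.start G.m := by
  have h : ∀ k ≤ G.m, ∑ u ∈ Finset.range k, (G.start (u + 1) - G.start u) = G.start k := by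
    intro k
    induction k with
    | zero => intro _; simp [G.start_zero]
    | succ k ih =>
      intro hk
      have := G.start_le k (by omega)
      rw [Finset.sum_range_succ, ih (by omega)]
      omega
  exact h _ le_rfl

theorem start_le_total (G : Incidence) {u : ℕ} (hu : u ≤ G.m) : G.start u ≤ G.start G.m := by
  induction hu using Nat.decreasingInduction with
  | self => exact le_rfl
  | of_succ k hk ih => exact (G.start_le k hk).trans ih

/-- The owners describe a matching: `owner v` is `0` if the variable `v` is not matched, and
`u + 1` if it is matched to clause `u`. -/
structure IsMatching (G : Incidence) (owner : ℕ → ℕ) : Prop where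
  le : ∀ v, owner v ≤ G.m
  adj : ∀ v, owner v ≠ 0 → G.Adj (owner v - 1) v
  inj : ∀ v v', owner v ≠ 0 → owner v = owner v' → v = v'

theorem IsMatching.saturable {G : Incidence} {owner : ℕ → ℕ} (h : G.IsMatching owner)
    (hall : ∀ u < G.m, ∃ v, owner v = u + 1) : G.Saturable := by
  choose! g hg using hall
  refine ⟨g, fun u hu => ?_, fun u hu u' hu' e => ?_⟩
  · have := h.adj (g u) (by rw [hg u hu]; omega)
    rwa [hg u hu] at this
  · have h1 := hg u hu
    have h2 := hg u' hu'
    rw [e] at h1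
    omega

/-- An unmatched clause may take over any of its variables from the present owner. -/
theorem IsMatching.update {G : Incidence} {owner : ℕ → ℕ} (h : G.IsMatching owner) {u v : ℕ}
    (hu : u < G.m) (hadj : G.Adj u v) (hfree : ∀ v', owner v' ≠ u + 1) :
    G.IsMatching (Function.update owner v (u + 1)) where
  le w := by have := h.le w; grind [Function.update_apply]
  adj w hw := by have := h.adj w; grind [Function.update_apply]
  inj w w' hw e := by have := h.inj w w'; grind [Function.update_apply]

/-! ### The auction -/

/-- The invariant of the auction with `L` price levels. All clauses `u ≤ i` other than `cur` are
settled: they own a variable, or they have been given up and are listed in `free`. No variable of a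
clause is cheaper than the level of the clause, those before its pointer are dearer, and the owner
of a variable paid at most its level plus one. -/
structure AuctionInv (G : Incidence) (L i cur f : ℕ) (ptr level price owner free : ℕ → ℕ) :
    Prop where
  matching : G.IsMatching owner
  cur_le : cur ≤ i
  le_i : ∀ v, owner v ≤ i + 1
  cur_free : ∀ v, owner v ≠ cur + 1
  settled : ∀ u ≤ i, u < G.m → u ≠ cur → (∃ v, owner v = u + 1) ∨ ∃ j < f, free j = u
  f_le : f ≤ i
  free_le : ∀ j < f, free j ≤ i
  free_lt : ∀ j < f, free j < G.m
  free_ne : ∀ j < f, free j ≠ cur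
  free_level : ∀ j < f, level (free j) = L
  free_unowned : ∀ j < f, ∀ v, owner v ≠ free j + 1
  free_inj : ∀ j < f, ∀ j' < f, free j = free j' → j = j'
  level_lt : ∀ u < G.m, level u < L ∨ ∃ j < f, free j = u
  le_ptr : ∀ u < G.m, G.start u ≤ ptr u
  ptr_le : ∀ u < G.m, ptr u ≤ G.start (u + 1)
  le_price : ∀ u < G.m, ∀ e, G.start u ≤ e → e < G.start (u + 1) → level u ≤ price (G.var e)
  lt_price : ∀ u < G.m, ∀ e, G.start u ≤ e → e < ptr u → level u < price (G.var e)
  owner_price : ∀ v, owner v ≠ 0 → price v ≤ level (owner v - 1) + 1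
  owned : ∀ v, price v ≠ 0 → owner v ≠ 0

/-- A bound for the number of steps that the auction still makes: on each of the remaining levels,
a clause advances its pointer through its list and is then raised. -/
def auctionPot (G : Incidence) (L : ℕ) (ptr level : ℕ → ℕ) : ℕ :=
  ∑ u ∈ Finset.range G.m,
    ((L - level u) * (G.start (u + 1) - G.start u + 1) - (ptr u - G.start u))

theorem auctionPot_init (G : Incidence) (L : ℕ) :
    G.auctionPot L G.start (fun _ => 0) = L * (G.start G.m + G.m) := by
  simp only [auctionPot, Nat.sub_self, Nat.sub_zero, ← Finset.mul_sum, Finset.sum_add_distrib,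
    G.sum_deg]
  simp

theorem auctionPot_lt {G : Incidence} {L : ℕ} {ptr level ptr' level' : ℕ → ℕ} (cur : ℕ)
    (hcur : cur < G.m) (hp : ∀ u ≠ cur, ptr' u = ptr u) (hl : ∀ u ≠ cur, level' u = level u)
    (h : (L - level' cur) * (G.start (cur + 1) - G.start cur + 1) - (ptr' cur - G.start cur) <
      (L - level cur) * (G.start (cur + 1) - G.start cur + 1) - (ptr cur - G.start cur)) :
    G.auctionPot L ptr' level' < G.auctionPot L ptr level := by
  refine Finset.sum_lt_sum (fun u _ => ?_) ⟨cur, Finset.mem_range.2 hcur, h⟩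
  by_cases hu : u = cur
  · subst hu; exact h.le
  · rw [hp u hu, hl u hu]

namespace AuctionInv

variable {G : Incidence} {L i cur f : ℕ} {ptr level price owner free : ℕ → ℕ}

theorem init (G : Incidence) {L : ℕ} (hL : 0 < L) {ptr : ℕ → ℕ}
    (hptr : ∀ u < G.m, ptr u = G.start u) :
    G.AuctionInv L 0 0 0 ptr (fun _ => 0) (fun _ => 0) (fun _ => 0) (fun _ => 0) := by
  have := G.start_le
  constructor <;> first | grind | skip
  constructor <;> grind

theorem level_cur (h : G.AuctionInv L i cur f ptr level price owner free) (hi : i < G.m) :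
    level cur < L := by
  have := h.level_lt cur (h.cur_le.trans_lt hi)
  have := h.free_ne
  grind

/-- The variable at the pointer is too expensive for the present level. -/
theorem skip (h : G.AuctionInv L i cur f ptr level price owner free) (hi : i < G.m)
    (he : ptr cur < G.start (cur + 1)) (hp : price (G.var (ptr cur)) ≠ level cur) :
    G.AuctionInv L i cur f (Function.update ptr cur (ptr cur + 1)) level price owner free := by
  have hc := h.cur_le.trans_lt hi
  have h1 := h.le_ptr
  have h2 := h.ptr_le
  have h3 := h.le_price
  have h4 := h.lt_price
  refine { h with le_ptr := ?_, ptr_le := ?_, lt_price := ?_ } <;> intros <;>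
    grind [Function.update_apply]

theorem advance_pot (h : G.AuctionInv L i cur f ptr level price owner free) (hi : i < G.m)
    (he : ptr cur < G.start (cur + 1)) :
    G.auctionPot L (Function.update ptr cur (ptr cur + 1)) level < G.auctionPot L ptr level := by
  have hc := h.cur_le.trans_lt hi
  refine auctionPot_lt cur hc (fun u hu => by simp [hu]) (fun _ _ => rfl) ?_
  have h0 := h.level_cur hi
  have h1 := h.le_ptr cur hc
  have h2 : 1 * (G.start (cur + 1) - G.start cur + 1) ≤
    (L - level cur) * (G.start (cur + 1) - G.start cur + 1) := Nat.mul_le_mul_right _ (by omega)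
  simp only [Function.update_self]
  omega

/-- A variable that nobody owns is taken, and the next clause becomes the current one. -/
theorem take (h : G.AuctionInv L i cur f ptr level price owner free) (hi : i < G.m)
    (he : ptr cur < G.start (cur + 1)) (hp : price (G.var (ptr cur)) = level cur)
    (ho : owner (G.var (ptr cur)) = 0) :
    G.AuctionInv L (i + 1) (i + 1) f (Function.update ptr cur (ptr cur + 1)) level
      (Function.update price (G.var (ptr cur)) (price (G.var (ptr cur)) + 1))
      (Function.update owner (G.var (ptr cur)) (cur + 1)) free := by
  have hc := h.cur_le.trans_lt hi
  have hci := h.cur_le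
  have hM := h.matching.update hc ⟨_, h.le_ptr _ hc, he, rfl⟩ h.cur_free
  generalize hv : G.var (ptr cur) = v at *
  exact
  { matching := hM
    cur_le := le_rfl
    le_i := fun w => by have := h.le_i w; grind [Function.update_apply]
    cur_free := fun w => by have := h.le_i w; grind [Function.update_apply]
    settled := fun u hu hum hne => by
      by_cases huc : u = cur
      · exact Or.inl ⟨v, by simp [huc]⟩
      · refine (h.settled u (by omega) hum huc).imp_left fun ⟨w, hw⟩ => ⟨w, ?_⟩
        grind [Function.update_apply]
    f_le := h.f_le.trans (Nat.le_succ i)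
    free_le := fun j hj => (h.free_le j hj).trans (Nat.le_succ i)
    free_lt := h.free_lt
    free_ne := fun j hj => (Nat.lt_succ_of_le (h.free_le j hj)).ne
    free_level := h.free_level
    free_unowned := fun j hj w => by
      have := h.free_unowned j hj w; have := h.free_ne j hj; grind [Function.update_apply]
    free_inj := h.free_inj
    level_lt := h.level_lt
    le_ptr := fun u hu => by have := h.le_ptr u hu; grind [Function.update_apply]
    ptr_le := fun u hu => by have := h.ptr_le u hu; grind [Function.update_apply]
    le_price := fun u hu e h1 h2 => by
      have := h.le_price u hu e h1 h2; grind [Function.update_apply]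
    lt_price := fun u hu e h1 h2 => by
      have := h.lt_price u hu e h1; grind [Function.update_apply]
    owner_price := fun w => by have := h.owner_price w; grind [Function.update_apply]
    owned := fun w => by have := h.owned w; grind [Function.update_apply] }

/-- A variable is taken over from its owner, who becomes the current clause. -/
theorem kick (h : G.AuctionInv L i cur f ptr level price owner free) (hi : i < G.m)
    (he : ptr cur < G.start (cur + 1)) (hp : price (G.var (ptr cur)) = level cur)
    (ho : owner (G.var (ptr cur)) ≠ 0) :
    G.AuctionInv L i (owner (G.var (ptr cur)) - 1) f (Function.update ptr cur (ptr cur + 1)) level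
      (Function.update price (G.var (ptr cur)) (price (G.var (ptr cur)) + 1))
      (Function.update owner (G.var (ptr cur)) (cur + 1)) free := by
  have hc := h.cur_le.trans_lt hi
  have hci := h.cur_le
  have hM := h.matching.update hc ⟨_, h.le_ptr _ hc, he, rfl⟩ h.cur_free
  generalize hv : G.var (ptr cur) = v at *
  have hinj := fun w => h.matching.inj v w ho
  have hvi := h.le_i v
  have hvc := h.cur_free v
  exact
  { matching := hM
    cur_le := by omega
    le_i := fun w => by have := h.le_i w; grind [Function.update_apply]
    cur_free := fun w => by have := hinj w; grind [Function.update_apply]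
    settled := fun u hu hum hne => by
      by_cases huc : u = cur
      · exact Or.inl ⟨v, by simp [huc]⟩
      · refine (h.settled u (by omega) hum huc).imp_left fun ⟨w, hw⟩ => ⟨w, ?_⟩
        grind [Function.update_apply]
    f_le := h.f_le
    free_le := h.free_le
    free_lt := h.free_lt
    free_ne := fun j hj => by have := h.free_unowned j hj v; omega
    free_level := h.free_level
    free_unowned := fun j hj w => by
      have := h.free_unowned j hj w; have := h.free_ne j hj; grind [Function.update_apply]
    free_inj := h.free_inj
    level_lt := h.level_lt
    le_ptr := fun u hu => by have := h.le_ptr u hu; grind [Function.update_apply]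
    ptr_le := fun u hu => by have := h.ptr_le u hu; grind [Function.update_apply]
    le_price := fun u hu e h1 h2 => by
      have := h.le_price u hu e h1 h2; grind [Function.update_apply]
    lt_price := fun u hu e h1 h2 => by
      have := h.lt_price u hu e h1; grind [Function.update_apply]
    owner_price := fun w => by have := h.owner_price w; grind [Function.update_apply]
    owned := fun w => by have := h.owned w; grind [Function.update_apply] }

/-- The list of the current clause is exhausted, and its level is raised. -/
theorem raise (h : G.AuctionInv L i cur f ptr level price owner free) (hi : i < G.m)
    (he : ¬ ptr cur < G.start (cur + 1)) (hl : level cur + 1 < L) :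
    G.AuctionInv L i cur f (Function.update ptr cur (G.start cur))
      (Function.update level cur (level cur + 1)) price owner free := by
  have hc := h.cur_le.trans_lt hi
  have hs := G.start_le cur hc
  exact
  { h with
    free_level := fun j hj => by
      have := h.free_level j hj; have := h.free_ne j hj; grind [Function.update_apply]
    level_lt := fun u hu => by have := h.level_lt u hu; grind [Function.update_apply]
    le_ptr := fun u hu => by have := h.le_ptr u hu; grind [Function.update_apply]
    ptr_le := fun u hu => by have := h.ptr_le u hu; grind [Function.update_apply]
    le_price := fun u hu e h1 h2 => by
      have := h.le_price u hu e h1 h2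
      have := h.lt_price u hu e h1
      grind [Function.update_apply]
    lt_price := fun u hu e h1 h2 => by
      have := h.lt_price u hu e h1
      grind [Function.update_apply]
    owner_price := fun w hw => by
      have := h.owner_price w hw; grind [Function.update_apply] }

theorem raise_pot (h : G.AuctionInv L i cur f ptr level price owner free) (hi : i < G.m)
    (he : ¬ ptr cur < G.start (cur + 1)) :
    G.auctionPot L (Function.update ptr cur (G.start cur))
      (Function.update level cur (level cur + 1)) < G.auctionPot L ptr level := by
  have hc := h.cur_le.trans_lt hi
  refine auctionPot_lt cur hc (fun u hu => by simp [hu]) (fun u hu => by simp [hu]) ?_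
  have h0 := h.level_cur hi
  have h1 := h.ptr_le cur hc
  simp only [Function.update_self]
  obtain ⟨d, hd⟩ := Nat.exists_eq_add_of_lt h0
  have e1 : L - level cur = d + 1 := by omega
  have e2 : L - (level cur + 1) = d := by omega
  rw [e1, e2, add_mul]
  omega

/-- The current clause reaches the top level and is given up. -/
theorem freeze (h : G.AuctionInv L i cur f ptr level price owner free) (hi : i < G.m)
    (he : ¬ ptr cur < G.start (cur + 1)) (hl : ¬ level cur + 1 < L) :
    G.AuctionInv L (i + 1) (i + 1) (f + 1) (Function.update ptr cur (G.start cur))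
      (Function.update level cur (level cur + 1)) price owner (Function.update free f cur) := by
  have hc := h.cur_le.trans_lt hi
  have hs := G.start_le cur hc
  have hlc := h.level_cur hi
  have key : ∀ u, (∃ j < f, free j = u) → ∃ j < f + 1, Function.update free f cur j = u := by
    rintro u ⟨j, hj, rfl⟩
    exact ⟨j, by omega, by rw [Function.update_of_ne hj.ne]⟩
  have keyc : ∃ j < f + 1, Function.update free f cur j = cur := ⟨f, by simp⟩
  have hci := h.cur_le
  have hf := h.f_le
  have hfree : ∀ j < f + 1, (j < f ∧ Function.update free f cur j = free j) ∨
      (j = f ∧ Function.update free f cur j = cur) := by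
    intro j hj; grind [Function.update_apply]
  exact
  { h with
    cur_le := le_rfl
    le_i := fun w => by have := h.le_i w; omega
    cur_free := fun w => by have := h.le_i w; omega
    settled := fun u hu hum hne => by
      by_cases huc : u = cur
      · exact Or.inr (huc ▸ keyc)
      · exact (h.settled u (by omega) hum huc).imp_right (key u)
    f_le := by omega
    free_le := fun j hj => by have := h.free_le j; have := hfree j hj; grind
    free_lt := fun j hj => by have := h.free_lt j; have := hfree j hj; grind
    free_ne := fun j hj => by have := h.free_le j; have := hfree j hj; grind
    free_level := fun j hj => by
      have := h.free_level j; have := h.free_ne j; have := hfree j hj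
      grind [Function.update_apply]
    free_unowned := fun j hj w => by
      have := h.free_unowned j; have := hfree j hj; have := h.cur_free w; grind
    free_inj := fun j hj j' hj' e => by
      have := h.free_inj j; have := hfree j hj; have := hfree j' hj'
      have := h.free_ne j; have := h.free_ne j'; grind
    le_ptr := fun u hu => by have := h.le_ptr u hu; grind [Function.update_apply]
    ptr_le := fun u hu => by have := h.ptr_le u hu; grind [Function.update_apply]
    level_lt := fun u hu => by
      by_cases huc : u = cur
      · exact Or.inr (huc ▸ keyc)
      · rw [Function.update_of_ne huc]
        exact (h.level_lt u hu).imp_right (key u)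
    le_price := fun u hu e h1 h2 => by
      have := h.le_price u hu e h1 h2
      have := h.lt_price u hu e h1
      grind [Function.update_apply]
    lt_price := fun u hu e h1 h2 => by
      have := h.lt_price u hu e h1
      grind [Function.update_apply]
    owner_price := fun w hw => by
      have := h.owner_price w hw; grind [Function.update_apply] }

/-- Linear programming duality: the prices show that a family with a system of distinct
representatives has few clauses that are given up. -/
theorem mul_le (h : G.AuctionInv L i cur f ptr level price owner free) (hG : G.Saturable) :
    f * L ≤ G.m := by
  obtain ⟨g, hadj, hinj⟩ := hG
  -- `T` holds the representatives that are owned in the auction, `A` their owners.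
  set T := ((Finset.range G.m).image g).filter fun v => owner v ≠ 0 with hT
  set A := T.image fun v => owner v - 1 with hA
  have hTo : ∀ v ∈ T, owner v ≠ 0 := fun v hv => (Finset.mem_filter.1 hv).2
  have hAm : A ⊆ Finset.range G.m := by
    intro u hu
    obtain ⟨v, hv, rfl⟩ := Finset.mem_image.1 hu
    have := hTo v hv
    have := h.matching.le v
    simp only [Finset.mem_range]
    omega
  -- The total price of all representatives is at most that of the representatives of `A`, plus
  -- `A.card`, so the representatives of the other clauses, those in `free` included, cost at most
  -- `A.card` together; but a clause in `free` has no variable that is cheaper than `L`.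
  have hlev : ∀ u < G.m, level u ≤ price (g u) := by
    intro u hu
    obtain ⟨e, h1, h2, h3⟩ := hadj u hu
    exact h3 ▸ h.le_price u hu e h1 h2
  have hsum : ∑ u ∈ Finset.range G.m, price (g u) = ∑ v ∈ T, price v := by
    rw [hT, Finset.sum_filter_of_ne fun v _ => h.owned v, Finset.sum_image]
    intro u hu u' hu' e
    exact hinj (by simpa using hu) (by simpa using hu') e
  have hTA : ∑ v ∈ T, price v ≤ ∑ u ∈ A, (price (g u) + 1) := by
    rw [hA, Finset.sum_image]
    · refine Finset.sum_le_sum fun v hv => ?_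
      have h1 := hTo v hv
      have h2 := h.matching.le v
      exact (h.owner_price v h1).trans (Nat.succ_le_succ (hlev _ (by omega)))
    · intro v hv v' hv' e
      have h1 := hTo v hv
      have h2 := hTo v' hv'
      simp only at e
      exact h.matching.inj v v' h1 (by omega)
  set F := (Finset.range f).image free with hF
  have hFc : F.card = f := by
    rw [hF, Finset.card_image_of_injOn, Finset.card_range]
    intro j hj j' hj' e
    exact h.free_inj j (by simpa using hj) j' (by simpa using hj') e
  have hFA : F ⊆ Finset.range G.m \ A := by
    intro u hu
    obtain ⟨j, hj, rfl⟩ := Finset.mem_image.1 hu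
    rw [Finset.mem_range] at hj
    refine Finset.mem_sdiff.2 ⟨Finset.mem_range.2 (h.free_lt j hj), fun hu => ?_⟩
    obtain ⟨v, hv, hvj⟩ := Finset.mem_image.1 hu
    have h1 := hTo v hv
    have h2 := h.free_unowned j hj v
    omega
  have hlow : f * L ≤ ∑ u ∈ F, price (g u) := by
    rw [← hFc, ← smul_eq_mul]
    refine Finset.card_nsmul_le_sum _ _ _ fun u hu => ?_
    obtain ⟨j, hj, rfl⟩ := Finset.mem_image.1 hu
    rw [Finset.mem_range] at hj
    exact h.free_level j hj ▸ hlev _ (h.free_lt j hj)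
  have hsub := Finset.sum_le_sum_of_subset (f := fun u => price (g u)) hFA
  have hsplit := Finset.sum_sdiff (f := fun u => price (g u)) hAm
  have hcard := Finset.card_le_card hAm
  rw [Finset.sum_add_distrib, Finset.sum_const, smul_eq_mul, mul_one] at hTA
  rw [Finset.card_range] at hcard
  omega

end AuctionInv
/-! ### The search for augmenting paths -/

/-- The invariant of the depth-first search that makes room for the free clause number `s`. The
visited clauses form the set `S`; a variable `v` is visited if `visit v = s + 1`. All clauses own a
variable, except for the current clause `cur` and the later free clauses. The search path is
`stackC 0, …, stackC sp = cur`, where `stackC j` took the variable `stackV j` from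
`stackC (j + 1)`. -/
structure SearchInv (G : Incidence) (f s sp cur : ℕ) (S : Finset ℕ)
    (ptr owner free visit stackC stackV : ℕ → ℕ) : Prop where
  matching : G.IsMatching owner
  lt : s < f
  free_lt : ∀ j < f, free j < G.m
  free_inj : ∀ j < f, ∀ j' < f, free j = free j' → j = j'
  free_unowned : ∀ j < f, s < j → ∀ v, owner v ≠ free j + 1
  free_ne : ∀ j < f, s < j → free j ≠ cur
  cur_free : ∀ v, owner v ≠ cur + 1
  settled : ∀ u < G.m, u ≠ cur → (∃ v, owner v = u + 1) ∨ ∃ j < f, s < j ∧ free j = u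
  mem_lt : ∀ u ∈ S, u < G.m
  owner_mem : ∀ v, visit v = s + 1 → owner v ≠ 0 ∧ owner v - 1 ∈ S
  visit_eq : ∀ v, owner v ≠ 0 → owner v - 1 ∈ S → visit v = s + 1
  visit_le : ∀ v, visit v ≤ s + 1
  le_ptr : ∀ u ∈ S, G.start u ≤ ptr u
  ptr_le : ∀ u ∈ S, ptr u ≤ G.start (u + 1)
  visited : ∀ u ∈ S, ∀ e, G.start u ≤ e → e < ptr u → visit (G.var e) = s + 1
  exhausted : ∀ u ∈ S, ptr u = G.start (u + 1) ∨ ∃ j ≤ sp, stackC j = u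
  stack_top : stackC sp = cur
  stack_mem : ∀ j ≤ sp, stackC j ∈ S
  stack_owner : ∀ j < sp, owner (stackV j) = stackC j + 1
  stack_inj : ∀ j ≤ sp, ∀ j' ≤ sp, stackC j = stackC j' → j = j'
  stack_adj : ∀ j < sp, G.Adj (stackC (j + 1)) (stackV j)
  lt_card : sp < S.card

/-- A bound for the number of terms that the search still looks at. -/
def searchPot (G : Incidence) (S : Finset ℕ) (ptr : ℕ → ℕ) : ℕ :=
  ∑ u ∈ Finset.range G.m,
    if u ∈ S then G.start (u + 1) - ptr u else G.start (u + 1) - G.start u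

/-- A bound for the number of steps that the searches still make. A term that is looked at counts
twice, since it may lead to a push, which is undone later. -/
def searchesPot (G : Incidence) (f s sp : ℕ) (S : Finset ℕ) (ptr : ℕ → ℕ) : ℕ :=
  (f - 1 - s) * (2 * G.start G.m + 1) + 2 * G.searchPot S ptr + sp + 1

namespace SearchInv

variable {G : Incidence} {f s sp cur : ℕ} {S : Finset ℕ}
  {ptr owner free visit stackC stackV : ℕ → ℕ}

/-- A search starts at a free clause, while no variable bears the stamp of the search. -/
theorem start (hM : G.IsMatching owner) (hlt : s < f) (hfl : ∀ j < f, free j < G.m)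
    (hfi : ∀ j < f, ∀ j' < f, free j = free j' → j = j')
    (hfu : ∀ j < f, s ≤ j → ∀ v, owner v ≠ free j + 1)
    (hset : ∀ u < G.m, (∃ v, owner v = u + 1) ∨ ∃ j < f, s ≤ j ∧ free j = u)
    (hv : ∀ v, visit v ≤ s) :
    G.SearchInv f s 0 (free s) {free s} (Function.update ptr (free s) (G.start (free s))) owner
      free visit (Function.update stackC 0 (free s)) stackV where
  matching := hM
  lt := hlt
  free_lt := hfl
  free_inj := hfi
  free_unowned j hj hs := hfu j hj hs.le
  free_ne j hj hs := by have := hfi j hj s hlt; grind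
  cur_free := hfu s hlt le_rfl
  settled u hu hne := by
    refine (hset u hu).imp_right ?_
    rintro ⟨j, hj, hs, rfl⟩
    refine ⟨j, hj, ?_, rfl⟩
    grind
  mem_lt u hu := by rw [Finset.mem_singleton.1 hu]; exact hfl s hlt
  owner_mem v h := by have := hv v; omega
  visit_eq v h0 h1 := by
    have := hfu s hlt le_rfl v
    rw [Finset.mem_singleton] at h1
    omega
  visit_le v := (hv v).trans (Nat.le_succ s)
  le_ptr u hu := by rw [Finset.mem_singleton.1 hu]; simp
  ptr_le u hu := by
    rw [Finset.mem_singleton.1 hu, Function.update_self]; exact G.start_le _ (hfl s hlt)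
  visited u hu e h1 h2 := by
    rw [Finset.mem_singleton.1 hu] at h1 h2
    rw [Function.update_self] at h2
    omega
  exhausted u hu := Or.inr ⟨0, le_rfl, by rw [Finset.mem_singleton.1 hu]; simp⟩
  stack_top := by simp
  stack_mem j hj := by simp [Nat.le_zero.1 hj]
  stack_owner j hj := by omega
  stack_inj j hj j' hj' _ := by omega
  stack_adj j hj := by omega
  lt_card := by simp

theorem cur_mem (h : G.SearchInv f s sp cur S ptr owner free visit stackC stackV) : cur ∈ S :=
  h.stack_top ▸ h.stack_mem sp le_rfl

theorem cur_lt (h : G.SearchInv f s sp cur S ptr owner free visit stackC stackV) : cur < G.m :=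
  h.mem_lt cur h.cur_mem

theorem sp_lt (h : G.SearchInv f s sp cur S ptr owner free visit stackC stackV) : sp < G.m := by
  have h1 : S ⊆ Finset.range G.m := fun u hu => Finset.mem_range.2 (h.mem_lt u hu)
  have h2 := Finset.card_le_card h1
  rw [Finset.card_range] at h2
  exact h.lt_card.trans_le h2

theorem le_m (h : G.SearchInv f s sp cur S ptr owner free visit stackC stackV) : f ≤ G.m := by
  have h1 := Finset.card_le_card_of_injOn (s := Finset.range f) (t := Finset.range G.m) free
    (fun j hj => by simpa using h.free_lt j (by simpa using hj))
    fun j hj j' hj' e => h.free_inj j (by simpa using hj) j' (by simpa using hj') e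
  simpa using h1

theorem searchPot_advance (h : G.SearchInv f s sp cur S ptr owner free visit stackC stackV)
    (he : ptr cur < G.start (cur + 1)) :
    G.searchPot S (Function.update ptr cur (ptr cur + 1)) < G.searchPot S ptr := by
  refine Finset.sum_lt_sum (fun u _ => ?_) ⟨cur, Finset.mem_range.2 h.cur_lt, ?_⟩
  · by_cases hu : u = cur
    · subst hu
      simp only [Function.update_self]
      split_ifs <;> omega
    · simp [hu]
  · simp only [h.cur_mem, if_true, Function.update_self]
    omega

/-- The variable at the pointer has been visited. -/
theorem skip (h : G.SearchInv f s sp cur S ptr owner free visit stackC stackV)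
    (he : ptr cur < G.start (cur + 1)) (hv : visit (G.var (ptr cur)) = s + 1) :
    G.SearchInv f s sp cur S (Function.update ptr cur (ptr cur + 1)) owner free visit stackC
      stackV :=
  { h with
    le_ptr := fun u hu => by have := h.le_ptr u hu; grind [Function.update_apply]
    ptr_le := fun u hu => by have := h.ptr_le u hu; grind [Function.update_apply]
    visited := fun u hu e h1 h2 => by
      have := h.visited u hu e h1; grind [Function.update_apply]
    exhausted := fun u hu => by
      by_cases huc : u = cur
      · exact Or.inr ⟨sp, le_rfl, huc ▸ h.stack_top⟩
      · rw [Function.update_of_ne huc]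
        exact h.exhausted u hu }

theorem skip_pot (h : G.SearchInv f s sp cur S ptr owner free visit stackC stackV)
    (he : ptr cur < G.start (cur + 1)) :
    G.searchesPot f s sp S (Function.update ptr cur (ptr cur + 1)) <
      G.searchesPot f s sp S ptr := by
  have := h.searchPot_advance he
  unfold searchesPot
  omega

theorem settled_of_take (h : G.SearchInv f s sp cur S ptr owner free visit stackC stackV)
    (ho : owner (G.var (ptr cur)) = 0) {u : ℕ} (hu : u < G.m) :
    (∃ v, Function.update owner (G.var (ptr cur)) (cur + 1) v = u + 1) ∨
      ∃ j < f, s + 1 ≤ j ∧ free j = u := by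
  by_cases huc : u = cur
  · exact Or.inl ⟨G.var (ptr cur), by simp [huc]⟩
  · refine (h.settled u hu huc).imp (fun ⟨v, hv⟩ => ⟨v, ?_⟩) id
    rw [Function.update_of_ne, hv]
    rintro rfl
    omega

theorem matching_take (h : G.SearchInv f s sp cur S ptr owner free visit stackC stackV)
    (he : ptr cur < G.start (cur + 1)) :
    G.IsMatching (Function.update owner (G.var (ptr cur)) (cur + 1)) :=
  h.matching.update h.cur_lt ⟨_, h.le_ptr _ h.cur_mem, he, rfl⟩ h.cur_free

/-- A variable that nobody owns is taken, which completes the search, and the next free clause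
becomes the current one. -/
theorem take (h : G.SearchInv f s sp cur S ptr owner free visit stackC stackV)
    (he : ptr cur < G.start (cur + 1)) (ho : owner (G.var (ptr cur)) = 0) (hs : s + 1 < f)
    (ptr' : ℕ → ℕ) :
    G.SearchInv f (s + 1) 0 (free (s + 1)) {free (s + 1)}
      (Function.update ptr' (free (s + 1)) (G.start (free (s + 1))))
      (Function.update owner (G.var (ptr cur)) (cur + 1)) free
      (Function.update visit (G.var (ptr cur)) (s + 1))
      (Function.update stackC 0 (free (s + 1))) stackV := by
  refine SearchInv.start (h.matching_take he) hs h.free_lt h.free_inj (fun j hj hsj v => ?_)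
    (fun u hu => h.settled_of_take ho hu) fun v => ?_
  · have := h.free_unowned j hj hsj v
    have := h.free_ne j hj hsj
    grind [Function.update_apply]
  · have := h.visit_le v
    grind [Function.update_apply]

theorem searchPot_start (G : Incidence) (ptr' : ℕ → ℕ) (u : ℕ) :
    G.searchPot {u} (Function.update ptr' u (G.start u)) = G.start G.m := by
  rw [← G.sum_deg]
  refine Finset.sum_congr rfl fun u' _ => ?_
  split_ifs with h
  · rw [Finset.mem_singleton.1 h, Function.update_self]
  · rfl

theorem take_pot (hs : s + 1 < f) {u : ℕ} {ptr' : ℕ → ℕ} :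
    G.searchesPot f (s + 1) 0 {u} (Function.update ptr' u (G.start u)) <
      G.searchesPot f s sp S ptr := by
  have h2 : f - 1 - s = (f - 1 - (s + 1)) + 1 := by omega
  unfold searchesPot
  rw [searchPot_start, h2, add_mul (f - 1 - (s + 1)), one_mul]
  omega

/-- When the last search is complete, the matching saturates all clauses. -/
theorem saturable (h : G.SearchInv f s sp cur S ptr owner free visit stackC stackV)
    (he : ptr cur < G.start (cur + 1)) (ho : owner (G.var (ptr cur)) = 0) (hs : ¬ s + 1 < f) :
    G.Saturable := by
  refine (h.matching_take he).saturable fun u hu => ?_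
  obtain hv | ⟨j, hj, hsj, -⟩ := h.settled_of_take ho hu
  · exact hv
  · omega

/-- The current clause takes an unvisited variable, whose owner becomes the current clause. -/
theorem push (h : G.SearchInv f s sp cur S ptr owner free visit stackC stackV)
    (he : ptr cur < G.start (cur + 1)) (hv : visit (G.var (ptr cur)) ≠ s + 1) {u : ℕ}
    (ho : owner (G.var (ptr cur)) = u + 1) :
    G.SearchInv f s (sp + 1) u (insert u S)
      (Function.update (Function.update ptr cur (ptr cur + 1)) u (G.start u))
      (Function.update owner (G.var (ptr cur)) (cur + 1)) free
      (Function.update visit (G.var (ptr cur)) (s + 1))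
      (Function.update stackC (sp + 1) u)
      (Function.update stackV sp (G.var (ptr cur))) := by
  have hM := h.matching_take he
  have hcur := h.cur_mem
  have hadj := h.matching.adj (G.var (ptr cur)) (by omega)
  have hle := h.matching.le (G.var (ptr cur))
  rw [ho, Nat.add_sub_cancel] at hadj
  have hinj : ∀ w, owner w = u + 1 → w = G.var (ptr cur) := fun w hw =>
    h.matching.inj w _ (by omega) (hw.trans ho.symm)
  have huS : u ∉ S := fun hu => hv (h.visit_eq _ (by omega) (by rwa [ho]))
  have huc : u ≠ cur := fun e => huS (e ▸ hcur)
  have hfu := fun j hj hs => h.free_unowned j hj hs (G.var (ptr cur))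
  have hstack : ∀ j ≤ sp, stackC j ≠ u := fun j hj e => huS (e ▸ h.stack_mem j hj)
  have hcarduS := Finset.card_insert_of_notMem huS
  have htop := h.stack_top
  have hstart := G.start_le u (by omega)
  generalize hw : G.var (ptr cur) = v at *
  exact
  { matching := hM
    lt := h.lt
    free_lt := h.free_lt
    free_inj := h.free_inj
    free_unowned := fun j hj hs w => by
      have := h.free_unowned j hj hs w; have := h.free_ne j hj hs; grind [Function.update_apply]
    free_ne := fun j hj hs => by have := hfu j hj hs; omega
    cur_free := fun w => by have := hinj w; grind [Function.update_apply]
    settled := fun u' hu' hne => by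
      by_cases huc : u' = cur
      · exact Or.inl ⟨v, by simp [huc]⟩
      · refine (h.settled u' hu' huc).imp_left fun ⟨w, hw⟩ => ⟨w, ?_⟩
        grind [Function.update_apply]
    mem_lt := fun u' hu' => by have := h.mem_lt u'; grind
    owner_mem := fun w hw => by have := h.owner_mem w; grind [Function.update_apply]
    visit_eq := fun w h0 h1 => by
      have := h.visit_eq w; have := hinj w; grind [Function.update_apply]
    visit_le := fun w => by have := h.visit_le w; grind [Function.update_apply]
    le_ptr := fun u' hu' => by have := h.le_ptr u'; grind [Function.update_apply]
    ptr_le := fun u' hu' => by have := h.ptr_le u'; grind [Function.update_apply]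
    visited := fun u' hu' e h1 h2 => by
      have := h.visited u'; grind [Function.update_apply]
    exhausted := fun u' hu' => by
      by_cases hu : u' = u
      · exact Or.inr ⟨sp + 1, le_rfl, by simp [hu]⟩
      · rw [Function.update_of_ne hu]
        have hS : u' ∈ S := (Finset.mem_insert.1 hu').resolve_left hu
        by_cases huc' : u' = cur
        · exact Or.inr ⟨sp, by omega, by simp [huc', htop]⟩
        · rw [Function.update_of_ne huc']
          refine (h.exhausted u' hS).imp_right fun ⟨j, hj, e⟩ => ⟨j, by omega, ?_⟩
          rw [Function.update_of_ne (by omega), e]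
    stack_top := by simp
    stack_mem := fun j hj => by have := h.stack_mem j; grind [Function.update_apply]
    stack_owner := fun j hj => by
      have := h.stack_owner j; have := hstack j
      grind [Function.update_apply]
    stack_inj := fun j hj j' hj' e => by
      have := h.stack_inj j; have := hstack j; have := hstack j'
      grind [Function.update_apply]
    stack_adj := fun j hj => by
      have := h.stack_adj j
      grind [Function.update_apply]
    lt_card := by have := h.lt_card; omega }

theorem push_pot (h : G.SearchInv f s sp cur S ptr owner free visit stackC stackV)
    (he : ptr cur < G.start (cur + 1)) (hv : visit (G.var (ptr cur)) ≠ s + 1) {u : ℕ}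
    (ho : owner (G.var (ptr cur)) = u + 1) :
    G.searchesPot f s (sp + 1) (insert u S)
      (Function.update (Function.update ptr cur (ptr cur + 1)) u (G.start u)) <
        G.searchesPot f s sp S ptr := by
  have huS : u ∉ S := fun hu => hv (h.visit_eq _ (by omega) (by rwa [ho]))
  have h1 := h.searchPot_advance he
  have h2 : G.searchPot (insert u S)
      (Function.update (Function.update ptr cur (ptr cur + 1)) u (G.start u)) =
      G.searchPot S (Function.update ptr cur (ptr cur + 1)) := by
    refine Finset.sum_congr rfl fun u' _ => ?_
    by_cases hu : u' = u
    · simp [hu, huS]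
    · simp [hu]
  unfold searchesPot
  omega

/-- The list of the current clause is exhausted: it regains the variable that was taken from it,
and the clause that took it continues. -/
theorem pop (h : G.SearchInv f s (sp + 1) cur S ptr owner free visit stackC stackV)
    (he : ¬ ptr cur < G.start (cur + 1)) :
    G.SearchInv f s sp (stackC sp) S ptr (Function.update owner (stackV sp) (cur + 1)) free visit
      stackC stackV := by
  have hadj := h.stack_adj sp (by omega)
  rw [h.stack_top] at hadj
  have hM := h.matching.update h.cur_lt hadj h.cur_free
  have hown := h.stack_owner sp (by omega)
  have hinj : ∀ w, owner w = stackC sp + 1 → w = stackV sp := fun w hw =>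
    h.matching.inj w _ (by omega) (hw.trans hown.symm)
  have hcur := h.cur_mem
  have hpS := h.stack_mem sp (by omega)
  have hvis := h.visit_eq (stackV sp) (by omega) (by rwa [hown])
  have hptr := h.ptr_le cur hcur
  have htop := h.stack_top
  have hne := h.cur_free (stackV sp)
  exact
  { h with
    matching := hM
    free_unowned := fun j hj hs w => by
      have := h.free_unowned j hj hs w; have := h.free_ne j hj hs; grind [Function.update_apply]
    free_ne := fun j hj hs => by have := h.free_unowned j hj hs (stackV sp); omega
    cur_free := fun w => by have := hinj w; grind [Function.update_apply]
    settled := fun u hu hne => by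
      by_cases huc : u = cur
      · exact Or.inl ⟨stackV sp, by simp [huc]⟩
      · refine (h.settled u hu huc).imp_left fun ⟨w, hw⟩ => ⟨w, ?_⟩
        grind [Function.update_apply]
    owner_mem := fun w hw => by have := h.owner_mem w; grind [Function.update_apply]
    visit_eq := fun w h0 h1 => by have := h.visit_eq w; grind [Function.update_apply]
    exhausted := fun u hu => by
      obtain h1 | ⟨j, hj, e⟩ := h.exhausted u hu
      · exact Or.inl h1
      · by_cases hjs : j = sp + 1
        · left
          rw [hjs, htop] at e
          subst e
          omega
        · exact Or.inr ⟨j, by omega, e⟩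
    stack_top := rfl
    stack_mem := fun j hj => h.stack_mem j (by omega)
    stack_owner := fun j hj => by
      have := h.stack_owner j (by omega)
      have := h.stack_inj j (by omega) sp (by omega)
      grind [Function.update_apply]
    stack_inj := fun j hj j' hj' e => h.stack_inj j (by omega) j' (by omega) e
    stack_adj := fun j hj => h.stack_adj j (by omega)
    lt_card := by have := h.lt_card; omega }

/-- Hall's condition: if the search returns to its root, then the visited clauses have fewer
variables than there are visited clauses. -/
theorem not_saturable (h : G.SearchInv f s 0 cur S ptr owner free visit stackC stackV)
    (he : ¬ ptr cur < G.start (cur + 1)) : ¬ G.Saturable := by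
  rintro ⟨g, hadj, hinj⟩
  have hex : ∀ u ∈ S, ptr u = G.start (u + 1) := by
    intro u hu
    obtain h1 | ⟨j, hj, e⟩ := h.exhausted u hu
    · exact h1
    · rw [Nat.le_zero.1 hj, h.stack_top] at e
      subst e
      have := h.ptr_le cur hu
      omega
  have hvis : ∀ u ∈ S, owner (g u) ≠ 0 ∧ owner (g u) - 1 ∈ S := by
    intro u hu
    obtain ⟨e, h1, h2, h3⟩ := hadj u (h.mem_lt u hu)
    exact h3 ▸ h.owner_mem _ (h.visited u hu e h1 (hex u hu ▸ h2))
  have hmaps : Set.MapsTo (fun u => owner (g u) - 1) S (S.erase cur) := by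
    intro u hu
    have h1 := hvis u hu
    have h2 := h.cur_free (g u)
    simp only [Finset.coe_erase, Set.mem_sdiff, Finset.mem_coe, Set.mem_singleton_iff]
    exact ⟨h1.2, by omega⟩
  have hcard := Finset.card_le_card_of_injOn _ hmaps fun u hu u' hu' e => by
    have h1 := hvis u hu
    have h2 := hvis u' hu'
    exact hinj (h.mem_lt u hu) (h.mem_lt u' hu') (h.matching.inj _ _ h1.1 (by omega))
  have := Finset.card_erase_lt_of_mem h.cur_mem
  omega

end SearchInv

end Incidence

/-! ### Total correctness with time credits -/

namespace WordRAM

/-- Program `c`, started in state `σ` with `k` units of time, halts within that time in a state `τ`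
such that `Q τ k'` holds, where at least `k'` units of time are left. -/
def Runs (w : ℕ) (c : Cmd) (σ : State) (k : ℕ) (Q : State → ℕ → Prop) : Prop :=
  ∃ t τ k', Exec w c σ t τ ∧ t + k' ≤ k ∧ Q τ k'

namespace Runs

variable {w : ℕ} {σ : State} {k : ℕ} {Q : State → ℕ → Prop}

theorem skip (h : Q σ k) : Runs w .skip σ (k + 1) Q :=
  ⟨_, _, k, .skip σ, (add_comm 1 k).le, h⟩

theorem const {r v : ℕ} (hv : v < 2 ^ w) (h : Q (σ.setReg r v) k) :
    Runs w (.const r v) σ (k + 1) Q :=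
  ⟨_, _, k, .const σ r v hv, (add_comm 1 k).le, h⟩

theorem copy {r a : ℕ} (h : Q (σ.setReg r (σ.reg a)) k) : Runs w (.copy r a) σ (k + 1) Q :=
  ⟨_, _, k, .copy σ r a, (add_comm 1 k).le, h⟩

theorem add {r a b : ℕ} (hv : σ.reg a + σ.reg b < 2 ^ w)
    (h : Q (σ.setReg r (σ.reg a + σ.reg b)) k) : Runs w (.add r a b) σ (k + 1) Q :=
  ⟨_, _, k, .add σ r a b hv, (add_comm 1 k).le, h⟩

theorem sub {r a b : ℕ} (h : Q (σ.setReg r (σ.reg a - σ.reg b)) k) :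
    Runs w (.sub r a b) σ (k + 1) Q :=
  ⟨_, _, k, .sub σ r a b, (add_comm 1 k).le, h⟩

theorem load {r A i : ℕ} (h : Q (σ.setReg r (σ.arr A (σ.reg i))) k) :
    Runs w (.load r A i) σ (k + 1) Q :=
  ⟨_, _, k, .load σ r A i, (add_comm 1 k).le, h⟩

theorem store {A i a : ℕ} (h : Q (σ.setArr A (σ.reg i) (σ.reg a)) k) :
    Runs w (.store A i a) σ (k + 1) Q :=
  ⟨_, _, k, .store σ A i a, (add_comm 1 k).le, h⟩

theorem seq {c₁ c₂ : Cmd} (h : Runs w c₁ σ k fun τ k' => Runs w c₂ τ k' Q) :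
    Runs w (.seq c₁ c₂) σ k Q := by
  obtain ⟨t₁, τ, k₁, h₁, e₁, t₂, υ, k₂, h₂, e₂, hQ⟩ := h
  exact ⟨_, _, k₂, .seq h₁ h₂, by omega, hQ⟩

theorem cond {b : Test} {c₁ c₂ : Cmd} (h₁ : b.Holds σ → Runs w c₁ σ k Q)
    (h₂ : ¬ b.Holds σ → Runs w c₂ σ k Q) : Runs w (.cond b c₁ c₂) σ (k + 1) Q := by
  by_cases hb : b.Holds σ
  · obtain ⟨t, τ, k', h, e, hQ⟩ := h₁ hb
    exact ⟨_, _, k', .condTrue hb h, by omega, hQ⟩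
  · obtain ⟨t, τ, k', h, e, hQ⟩ := h₂ hb
    exact ⟨_, _, k', .condFalse hb h, by omega, hQ⟩

theorem mono {c : Cmd} {k' : ℕ} (h : Runs w c σ k Q) (hk : k ≤ k') : Runs w c σ k' Q := by
  obtain ⟨t, τ, j, h, e, hQ⟩ := h
  exact ⟨t, τ, j, h, e.trans hk, hQ⟩

/-- A loop with invariant `I`, whose second argument is a potential that bounds the number of
iterations. -/
theorem loop {b : Test} {c : Cmd} {a : ℕ} (I : State → ℕ → Prop)
    (hstep : ∀ σ Φ, I σ Φ → b.Holds σ → Runs w c σ a fun τ _ => ∃ Φ' < Φ, I τ Φ')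
    {Φ : ℕ} (hI : I σ Φ) (hQ : ∀ τ Φ', I τ Φ' → ¬ b.Holds τ → Q τ k) :
    Runs w (.loop b c) σ (k + (a + 1) * Φ + 1) Q := by
  induction Φ using Nat.strong_induction_on generalizing σ with
  | _ Φ ih =>
    by_cases hb : b.Holds σ
    · obtain ⟨t, τ, k₁, h₁, e, Φ', hΦ, hI'⟩ := hstep σ Φ hI hb
      obtain ⟨t', υ, k₂, h₂, e₂, hQ'⟩ := ih Φ' hΦ hI'
      have h3 : (a + 1) * (Φ' + 1) ≤ (a + 1) * Φ := Nat.mul_le_mul_left _ hΦ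
      rw [Nat.mul_add (a + 1) Φ' 1] at h3
      exact ⟨_, υ, k₂, .loopTrue hb h₁ h₂, by omega, hQ'⟩
    · exact ⟨1, σ, k, .loopFalse hb, by omega, hQ σ _ hI hb⟩

end Runs

end WordRAM

/-! ### The program -/

namespace WordRAM

open Incidence

/- Registers. The register of the input that holds `n` is not used. -/
namespace Reg

/-- The number of clauses, and the answer at the end. -/
@[simp] abbrev m : ℕ := 0
/-- Constantly zero. -/
@[simp] abbrev zero : ℕ := 2
/-- Constantly one. -/
@[simp] abbrev one : ℕ := 3
/-- The number of clauses that have been located. -/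
@[simp] abbrev k : ℕ := 4
/-- The position in the list of terms. -/
@[simp] abbrev pos : ℕ := 5
/-- The length of a clause. -/
@[simp] abbrev len : ℕ := 6
/-- The number of price levels. -/
@[simp] abbrev L : ℕ := 7
/-- The square of the number of price levels. -/
@[simp] abbrev sq : ℕ := 8
/-- The number of clauses that the auction has finished. -/
@[simp] abbrev i : ℕ := 9
/-- The clause that looks for a variable. -/
@[simp] abbrev cur : ℕ := 10
/-- The number of clauses that the auction has given up. -/
@[simp] abbrev f : ℕ := 11
/-- The position of the term under consideration. -/
@[simp] abbrev e : ℕ := 12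
/-- The name of the current clause as an owner. -/
@[simp] abbrev succCur : ℕ := 13
/-- The end of the current clause. -/
@[simp] abbrev finish : ℕ := 14
/-- A new value of a pointer. -/
@[simp] abbrev t : ℕ := 15
/-- A variable. -/
@[simp] abbrev v : ℕ := 16
/-- The price of the variable. -/
@[simp] abbrev price : ℕ := 17
/-- The level of the clause. -/
@[simp] abbrev level : ℕ := 18
/-- The former owner of the variable. -/
@[simp] abbrev owner : ℕ := 19
/-- The number of finished searches. -/
@[simp] abbrev s : ℕ := 20
/-- The height of the stack. -/
@[simp] abbrev sp : ℕ := 21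
/-- Whether no search has failed. -/
@[simp] abbrev ok : ℕ := 22
/-- The stamp of the present search. -/
@[simp] abbrev stamp : ℕ := 23
/-- The stamp of the variable. -/
@[simp] abbrev visit : ℕ := 24

end Reg

/- Arrays; the input occupies the first two. -/
namespace Arr

/-- The lengths of the clauses. -/
@[simp] abbrev len : ℕ := 0
/-- The terms of the clauses. -/
@[simp] abbrev var : ℕ := 1
/-- The positions where the clauses start. -/
@[simp] abbrev start : ℕ := 2
/-- For every clause, the position of the next term to look at. -/
@[simp] abbrev ptr : ℕ := 3
/-- The levels of the clauses. -/
@[simp] abbrev level : ℕ := 4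
/-- The prices of the variables. -/
@[simp] abbrev price : ℕ := 5
/-- For every variable, one plus the clause that owns it, or zero. -/
@[simp] abbrev owner : ℕ := 6
/-- The clauses that the auction has given up. -/
@[simp] abbrev free : ℕ := 7
/-- The clauses on the search path. -/
@[simp] abbrev stackC : ℕ := 8
/-- The variables on the search path. -/
@[simp] abbrev stackV : ℕ := 9
/-- For every variable, the number of the last search that visited it, counted from one. -/
@[simp] abbrev visit : ℕ := 10

end Arr

local infixr:60 " ;; " => Cmd.seq

/-- One step of the auction. The current clause looks at its next term, and takes it if its price
equals the level of the clause. Then the former owner becomes the current clause, or, if there is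
none, the next clause does. A clause at the end of its list starts again one level higher; at level
`L` it is given up. -/
def auctionBody : Cmd :=
  .load Reg.e Arr.ptr Reg.cur ;; .add Reg.succCur Reg.cur Reg.one ;;
  .load Reg.finish Arr.start Reg.succCur ;;
  .cond (.lt Reg.e Reg.finish)
    (.add Reg.t Reg.e Reg.one ;; .store Arr.ptr Reg.cur Reg.t ;; .load Reg.v Arr.var Reg.e ;;
      .load Reg.price Arr.price Reg.v ;; .load Reg.level Arr.level Reg.cur ;;
      .cond (.eq Reg.price Reg.level)
        (.add Reg.price Reg.price Reg.one ;; .store Arr.price Reg.v Reg.price ;;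
          .load Reg.owner Arr.owner Reg.v ;; .store Arr.owner Reg.v Reg.succCur ;;
          .cond (.eq Reg.owner Reg.zero)
            (.add Reg.i Reg.i Reg.one ;; .copy Reg.cur Reg.i)
            (.sub Reg.cur Reg.owner Reg.one))
        .skip)
    (.load Reg.level Arr.level Reg.cur ;; .add Reg.level Reg.level Reg.one ;;
      .store Arr.level Reg.cur Reg.level ;; .load Reg.t Arr.start Reg.cur ;;
      .store Arr.ptr Reg.cur Reg.t ;;
      .cond (.lt Reg.level Reg.L)
        .skip
        (.store Arr.free Reg.f Reg.cur ;; .add Reg.f Reg.f Reg.one ;;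
          .add Reg.i Reg.i Reg.one ;; .copy Reg.cur Reg.i))

/-- The registers and arrays that the auction and the searches only read. -/
structure Prepared (G : Incidence) (L : ℕ) (σ : State) : Prop where
  m : σ.reg Reg.m = G.m
  zero : σ.reg Reg.zero = 0
  one : σ.reg Reg.one = 1
  levels : σ.reg Reg.L = L
  var : σ.arr Arr.var = G.var
  start : σ.arr Arr.start = G.start

/-- The loop invariant of the auction, with the potential `Φ`. -/
structure AuctionState (G : Incidence) (L : ℕ) (σ : State) (Φ : ℕ) : Prop
    extends Prepared G L σ where
  inv : G.AuctionInv L (σ.reg Reg.i) (σ.reg Reg.cur) (σ.reg Reg.f) (σ.arr Arr.ptr)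
    (σ.arr Arr.level) (σ.arr Arr.price) (σ.arr Arr.owner) (σ.arr Arr.free)
  i_le : σ.reg Reg.i ≤ G.m
  cur_eq : σ.reg Reg.i = G.m → σ.reg Reg.cur = G.m
  pot : G.auctionPot L (σ.arr Arr.ptr) (σ.arr Arr.level) = Φ
  s : σ.reg Reg.s = 0
  visit : σ.arr Arr.visit = fun _ => 0

theorem runs_auctionBody {w : ℕ} {G : Incidence} {L : ℕ} (hL : L ≤ G.m)
    (hw : G.start G.m + 4 * G.m + 4 ≤ 2 ^ w) {σ : State} {Φ : ℕ} (h : AuctionState G L σ Φ)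
    (hi : σ.reg Reg.i < σ.reg Reg.m) :
    Runs w auctionBody σ 20 fun τ _ => ∃ Φ' < Φ, AuctionState G L τ Φ' := by
  obtain ⟨⟨hm, h0, h1, hLr, hv, hs⟩, h, hi', -, rfl, hs0, hvis⟩ := h
  rw [hm] at hi
  have hc := h.cur_le.trans_lt hi
  have hlev := h.level_cur hi
  have hptr := h.ptr_le _ hc
  have hE := G.start_le_total (u := σ.reg Reg.cur + 1) hc
  have hf := h.f_le
  -- Registers and arrays appear as numerals from here on, so that lookups in updated states can be
  -- evaluated.
  simp only [Reg.m, Reg.zero, Reg.one, Reg.L, Reg.i, Reg.cur, Reg.f, Reg.s, Arr.ptr, Arr.level,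
    Arr.price, Arr.owner, Arr.free, Arr.var, Arr.start, Arr.visit] at *
  refine .seq <| .load <| .seq <| .add ?_ <| .seq <| .load <| .cond (fun hb => ?_) fun hb => ?_
  · simp [State.setReg, h1]; omega
  · simp [State.setReg, Test.Holds, h1, hs] at hb
    refine .seq <| .add ?_ <| .seq <| .store <| .seq <| .load <| .seq <| .load <| .seq <| .load <|
      .cond (fun hp => ?_) fun hp => ?_
    · simp [State.setReg, h1]; omega
    · simp [State.setReg, State.setArr, Test.Holds, h1, hv] at hp
      refine .seq <| .add ?_ <| .seq <| .store <| .seq <| .load <| .seq <| .store <|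
        .cond (fun ho => .seq <| .add ?_ <| .copy ?_) fun ho => .sub ?_
      · simp [State.setReg, State.setArr, h1, hv]; omega
      · simp [State.setReg, State.setArr, h1, hv]; omega
      · simp [State.setReg, State.setArr, Test.Holds, h0, hv] at ho
        refine ⟨_, h.advance_pot hi hb, ⟨?_, ?_, ?_, ?_, ?_, ?_⟩, ?_, ?_, ?_, ?_, ?_, ?_⟩
        case refine_7 => simpa [State.setReg, State.setArr, h1, hv] using h.take hi hb hp ho
        all_goals simp [State.setReg, State.setArr, *]
      · simp [State.setReg, State.setArr, Test.Holds, h0, hv] at ho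
        refine ⟨_, h.advance_pot hi hb, ⟨?_, ?_, ?_, ?_, ?_, ?_⟩, ?_, ?_, ?_, ?_, ?_, ?_⟩
        case refine_7 => simpa [State.setReg, State.setArr, h1, hv] using h.kick hi hb hp ho
        all_goals simp [State.setReg, State.setArr, hi.ne, *]
    · simp [State.setReg, State.setArr, Test.Holds, h1, hv] at hp
      refine .skip ⟨_, h.advance_pot hi hb, ⟨?_, ?_, ?_, ?_, ?_, ?_⟩, ?_, ?_, ?_, ?_, ?_, ?_⟩
      case refine_7 => simpa [State.setReg, State.setArr, h1, hv] using h.skip hi hb hp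
      all_goals simp [State.setReg, State.setArr, hi.ne, *]
  · simp [State.setReg, Test.Holds, h1, hs] at hb
    refine .seq <| .load <| .seq <| .add ?_ <| .seq <| .store <| .seq <| .load <| .seq <| .store <|
      .cond (fun hl => .skip ?_) fun hl => .seq <| .store <| .seq <| .add ?_ <| .seq <| .add ?_ <|
        .copy ?_
    · simp [State.setReg, h1]; omega
    · simp [State.setReg, State.setArr, Test.Holds, h1, hLr] at hl
      refine ⟨_, h.raise_pot hi (by omega), ⟨?_, ?_, ?_, ?_, ?_, ?_⟩, ?_, ?_, ?_, ?_, ?_, ?_⟩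
      case refine_7 =>
        simpa [State.setReg, State.setArr, h1, hs] using h.raise hi (by omega) hl
      all_goals simp [State.setReg, State.setArr, hi.ne, *]
    · simp [State.setReg, State.setArr, h1]; omega
    · simp [State.setReg, State.setArr, h1]; omega
    · simp [State.setReg, State.setArr, Test.Holds, h1, hLr] at hl
      refine ⟨_, h.raise_pot hi (by omega), ⟨?_, ?_, ?_, ?_, ?_, ?_⟩, ?_, ?_, ?_, ?_, ?_, ?_⟩
      case refine_7 =>
        simpa [State.setReg, State.setArr, h1, hs] using h.freeze hi (by omega) (by omega)
      all_goals simp [State.setReg, State.setArr, *]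

/-- The next clause that the auction has given up becomes the root of a search. -/
def searchBegin : Cmd :=
  .load Reg.cur Arr.free Reg.s ;; .copy Reg.sp Reg.zero ;; .load Reg.t Arr.start Reg.cur ;;
  .store Arr.ptr Reg.cur Reg.t ;; .store Arr.stackC Reg.sp Reg.cur

/-- One step of a search. The current clause looks at its next term. If that variable has not been
visited in this search, it is taken; then its former owner is pushed on the stack, or, if there is
none, the search is complete. A clause at the end of its list regains the variable that was taken
from it; at the root, the search has failed, and the loop is left. -/
def searchBody : Cmd :=
  .load Reg.e Arr.ptr Reg.cur ;; .add Reg.succCur Reg.cur Reg.one ;;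
  .load Reg.finish Arr.start Reg.succCur ;;
  .cond (.lt Reg.e Reg.finish)
    (.add Reg.t Reg.e Reg.one ;; .store Arr.ptr Reg.cur Reg.t ;; .load Reg.v Arr.var Reg.e ;;
      .add Reg.stamp Reg.s Reg.one ;; .load Reg.visit Arr.visit Reg.v ;;
      .cond (.eq Reg.visit Reg.stamp)
        .skip
        (.store Arr.visit Reg.v Reg.stamp ;; .load Reg.owner Arr.owner Reg.v ;;
          .store Arr.owner Reg.v Reg.succCur ;;
          .cond (.eq Reg.owner Reg.zero)
            (.add Reg.s Reg.s Reg.one ;; searchBegin)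
            (.store Arr.stackV Reg.sp Reg.v ;; .add Reg.sp Reg.sp Reg.one ;;
              .sub Reg.cur Reg.owner Reg.one ;; .store Arr.stackC Reg.sp Reg.cur ;;
              .load Reg.t Arr.start Reg.cur ;; .store Arr.ptr Reg.cur Reg.t)))
    (.cond (.eq Reg.sp Reg.zero)
      (.copy Reg.s Reg.f ;; .copy Reg.ok Reg.zero)
      (.sub Reg.sp Reg.sp Reg.one ;; .load Reg.v Arr.stackV Reg.sp ;;
        .store Arr.owner Reg.v Reg.succCur ;; .load Reg.cur Arr.stackC Reg.sp))

/-- The loop invariant of the searches, with the potential `Φ`: either a search is under way, or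
the answer is known. -/
def SearchState (G : Incidence) (L : ℕ) (σ : State) (Φ : ℕ) : Prop :=
  Prepared G L σ ∧
    ((σ.reg Reg.ok = 1 ∧ ∃ S, G.SearchInv (σ.reg Reg.f) (σ.reg Reg.s) (σ.reg Reg.sp)
        (σ.reg Reg.cur) S (σ.arr Arr.ptr) (σ.arr Arr.owner) (σ.arr Arr.free) (σ.arr Arr.visit)
        (σ.arr Arr.stackC) (σ.arr Arr.stackV) ∧
        G.searchesPot (σ.reg Reg.f) (σ.reg Reg.s) (σ.reg Reg.sp) S (σ.arr Arr.ptr) = Φ) ∨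
      (σ.reg Reg.f ≤ σ.reg Reg.s ∧
        (σ.reg Reg.ok = 1 ∧ G.Saturable ∨ σ.reg Reg.ok = 0 ∧ ¬ G.Saturable)))

theorem runs_searchBody {w : ℕ} {G : Incidence} {L : ℕ}
    (hw : G.start G.m + 4 * G.m + 4 ≤ 2 ^ w) {σ : State} {Φ : ℕ} (h : SearchState G L σ Φ)
    (hb : σ.reg Reg.s < σ.reg Reg.f) :
    Runs w searchBody σ 25 fun τ _ => ∃ Φ' < Φ, SearchState G L τ Φ' := by
  obtain ⟨⟨hm, h0, h1, hLr, hvar, hs⟩, ⟨hok, S, h, rfl⟩ | h⟩ := h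
  swap
  · exact absurd hb h.1.not_gt
  have hc := h.cur_lt
  have hptr := h.ptr_le _ h.cur_mem
  have hE := G.start_le_total (u := σ.reg Reg.cur + 1) hc
  have hf := h.le_m
  have hsp := h.sp_lt
  simp only [Reg.m, Reg.zero, Reg.one, Reg.L, Reg.ok, Reg.cur, Reg.f, Reg.s, Reg.sp, Arr.ptr,
    Arr.owner, Arr.free, Arr.var, Arr.start, Arr.visit, Arr.stackC, Arr.stackV] at *
  refine .seq <| .load <| .seq <| .add ?_ <| .seq <| .load <| .cond (fun he => ?_) fun he => ?_
  · simp [State.setReg, h1]; omega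
  · simp [State.setReg, Test.Holds, h1, hs] at he
    refine .seq <| .add ?_ <| .seq <| .store <| .seq <| .load <| .seq <| .add ?_ <| .seq <| .load <|
      .cond (fun hv => .skip ?_) fun hv => .seq <| .store <| .seq <| .load <| .seq <| .store <|
        .cond (fun ho => .seq <| .add ?_ <| .seq <| .load <| .seq <| .copy <| .seq <| .load <|
            .seq <| .store <| .store ?_)
          fun ho => .seq <| .store <| .seq <| .add ?_ <| .seq <| .sub <| .seq <| .store <|
            .seq <| .load <| .store ?_
    · simp [State.setReg, h1]; omega
    · simp [State.setReg, State.setArr, h1]; omega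
    · simp [State.setReg, State.setArr, Test.Holds, h1, hvar] at hv
      refine ⟨_, h.skip_pot he, ⟨?_, ?_, ?_, ?_, ?_, ?_⟩, Or.inl ⟨?_, S, ?_, ?_⟩⟩
      case refine_8 => simpa [State.setReg, State.setArr, h1] using h.skip he hv
      all_goals simp [State.setReg, State.setArr, *]
    · simp [State.setReg, State.setArr, h1]; omega
    · simp [State.setReg, State.setArr, Test.Holds, h0, hvar] at ho
      -- After the last search, the next root is a junk value, which does no harm.
      by_cases hlast : σ.reg 20 + 1 < σ.reg 11
      · refine ⟨_, SearchInv.take_pot hlast (u := σ.arr 7 (σ.reg 20 + 1))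
            (ptr' := Function.update (σ.arr 3) (σ.reg 10)
              (σ.arr 3 (σ.reg 10) + 1)),
          ⟨?_, ?_, ?_, ?_, ?_, ?_⟩, Or.inl ⟨?_, {σ.arr 7 (σ.reg 20 + 1)}, ?_, ?_⟩⟩
        case refine_8 =>
          simpa [State.setReg, State.setArr, h0, h1, hs, hvar] using h.take he ho hlast _
        all_goals simp [State.setReg, State.setArr, *]
      · refine ⟨0, Nat.succ_pos _, ⟨?_, ?_, ?_, ?_, ?_, ?_⟩, Or.inr ⟨?_, Or.inl ⟨?_, ?_⟩⟩⟩
        case refine_9 => exact h.saturable he ho hlast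
        all_goals simp [State.setReg, State.setArr, *]
        exact not_lt.1 hlast
    · simp [State.setReg, State.setArr, h1]; omega
    · simp [State.setReg, State.setArr, Test.Holds, h1, hvar] at hv
      simp [State.setReg, State.setArr, Test.Holds, h0, hvar] at ho
      have ho' := (Nat.sub_one_add_one ho).symm
      refine ⟨_, h.push_pot he hv ho', ⟨?_, ?_, ?_, ?_, ?_, ?_⟩,
        Or.inl ⟨?_, insert (σ.arr 6 (G.var (σ.arr 3 (σ.reg 10))) - 1) S, ?_, ?_⟩⟩
      case refine_8 =>
        simpa [State.setReg, State.setArr, h1, hs, hvar] using h.push he hv ho'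
      all_goals simp [State.setReg, State.setArr, hm, h0, h1, hLr, hvar, hs, hok]
  · simp [State.setReg, Test.Holds, h1, hs] at he
    refine .cond (fun hz => .seq <| .copy <| .copy ?_) fun hz => .seq <| .sub <| .seq <| .load <|
      .seq <| .store <| .load ?_
    · simp [State.setReg, Test.Holds, h0] at hz
      refine ⟨0, Nat.succ_pos _, ⟨?_, ?_, ?_, ?_, ?_, ?_⟩, Or.inr ⟨?_, Or.inr ⟨?_, ?_⟩⟩⟩
      case refine_9 => rw [hz] at h; exact h.not_saturable (by omega)
      all_goals simp [State.setReg, *]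
    · simp [State.setReg, Test.Holds, h0] at hz
      obtain ⟨q, hq⟩ := Nat.exists_eq_succ_of_ne_zero hz
      refine ⟨G.searchesPot (σ.reg 11) (σ.reg 20) q S (σ.arr 3), ?_,
        ⟨?_, ?_, ?_, ?_, ?_, ?_⟩, Or.inl ⟨?_, S, ?_, ?_⟩⟩
      case refine_1 => rw [hq]; unfold searchesPot; omega
      case refine_9 =>
        rw [hq] at h
        simpa [State.setReg, State.setArr, h1, hq] using h.pop (by omega)
      all_goals simp [State.setReg, State.setArr, *]

/-- The clauses that the auction has given up are served one by one. If there are more than `L` of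
them, the answer is negative by `AuctionInv.mul_le`. -/
def search : Cmd :=
  .cond (.lt Reg.L Reg.f)
    (.copy Reg.m Reg.zero)
    (.const Reg.ok 1 ;; searchBegin ;; .loop (.lt Reg.s Reg.f) searchBody ;; .copy Reg.m Reg.ok)

theorem runs_search {w : ℕ} {G : Incidence} {L : ℕ} (hL : L ≤ G.m) (hmL : G.m ≤ L * L)
    (hm : 0 < G.m)
    (hw : G.start G.m + 4 * G.m + 4 ≤ 2 ^ w) {σ : State} {Φ : ℕ} (h : AuctionState G L σ Φ)
    (hb : ¬ σ.reg Reg.i < σ.reg Reg.m) :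
    Runs w search σ (10 + 26 * (L * (2 * G.start G.m + 1))) fun τ _ =>
      (G.Saturable → τ.reg 0 = 1) ∧ (¬ G.Saturable → τ.reg 0 = 0) := by
  obtain ⟨⟨hm, h0, h1, hLr, hvar, hs⟩, h, hi', hcur, rfl, hs0, hvis⟩ := h
  rw [hm, not_lt] at hb
  have hi := le_antisymm hi' hb
  rw [hi, hcur hi] at h
  simp only [Reg.m, Reg.zero, Reg.one, Reg.L, Reg.cur, Reg.f, Reg.s, Arr.ptr,
    Arr.owner, Arr.free, Arr.var, Arr.start, Arr.visit] at *
  rw [add_comm]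
  refine .cond (fun hlt => .mono (k := 0 + 1) (.copy ⟨fun hG => ?_, fun _ => ?_⟩) (by omega))
    fun hlt => ?_
  · exfalso
    simp only [Test.Holds, hLr] at hlt
    have h1 := h.mul_le hG
    have h2 : (L + 1) * L ≤ σ.reg 11 * L := Nat.mul_le_mul_right L hlt
    rw [add_mul] at h2
    have hL0 : 0 < L := Nat.pos_of_ne_zero fun e => by subst e; omega
    omega
  · simpa [State.setReg] using h0
  · simp only [Test.Holds, hLr] at hlt
    refine .seq <| .const (by omega) <| .seq <| .seq <| .load <| .seq <| .copy <| .seq <| .load <|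
      .seq <| .store <| .store <| .seq ?_
    have hQ : ∀ τ Φ, SearchState G L τ Φ → ¬ Test.Holds τ (.lt Reg.s Reg.f) →
        Runs w (.copy Reg.m Reg.ok) τ 1 fun τ _ =>
          (G.Saturable → τ.reg 0 = 1) ∧ (¬ G.Saturable → τ.reg 0 = 0) := by
      rintro τ Φ ⟨-, ⟨-, S, h, -⟩ | ⟨-, h⟩⟩ hb
      · exact absurd h.lt hb
      · refine .copy ?_
        simp only [State.setReg, Reg.m, Reg.ok, Function.update_self]
        tauto
    by_cases hf : σ.reg 11 = 0
    · refine .mono (.loop (SearchState G L) (Φ := 0) (fun τ Φ => runs_searchBody hw)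
        ⟨⟨?_, ?_, ?_, ?_, ?_, ?_⟩, Or.inr ⟨?_, Or.inl ⟨?_, ?_⟩⟩⟩ hQ) (by omega)
      case refine_9 =>
        refine h.matching.saturable fun u hu => ?_
        obtain h | ⟨j, hj, -⟩ := h.settled u hu.le hu hu.ne
        · exact h
        · omega
      all_goals simp [State.setReg, State.setArr, *]
    · have hf0 := Nat.pos_of_ne_zero hf
      refine .mono (.loop (SearchState G L) (fun τ Φ => runs_searchBody hw)
        ⟨⟨?_, ?_, ?_, ?_, ?_, ?_⟩, Or.inl ⟨?_, {σ.arr 7 0}, ?_, rfl⟩⟩ hQ) ?_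
      case refine_8 =>
        simpa [State.setReg, State.setArr, hs0, h0, hs, hvis] using
          SearchInv.start (visit := fun _ => 0) (stackV := σ.arr 9)
            (stackC := σ.arr 8) (ptr := σ.arr 3) h.matching hf0 h.free_lt h.free_inj
            (fun j hj _ => h.free_unowned j hj)
            (fun u hu => by simpa using h.settled u hu.le hu hu.ne) fun _ => le_rfl
      case refine_9 =>
        simp [State.setReg, State.setArr, hs0, h0, hs, searchesPot, SearchInv.searchPot_start]
        obtain ⟨q, hq⟩ := Nat.exists_eq_succ_of_ne_zero hf
        have hqL : (q + 1) * (2 * G.start G.m + 1) ≤ L * (2 * G.start G.m + 1) :=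
          Nat.mul_le_mul_right _ (hq.symm.trans_le (not_lt.1 hlt))
        rw [hq, Nat.succ_sub_one]
        rw [add_mul q] at hqL
        omega
      all_goals simp [State.setReg, State.setArr, *]

/-- The start of clause `k` is stored, and that of the next clause is computed. -/
def startsBody : Cmd :=
  .load Reg.len Arr.len Reg.k ;; .store Arr.ptr Reg.k Reg.pos ;; .add Reg.pos Reg.pos Reg.len ;;
  .add Reg.k Reg.k Reg.one ;; .store Arr.start Reg.k Reg.pos

/-- The number of levels is raised by one, and its square is brought up to date: it grows by the old
and the new number of levels. -/
def levelsBody : Cmd :=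
  .add Reg.sq Reg.sq Reg.L ;; .add Reg.L Reg.L Reg.one ;; .add Reg.sq Reg.sq Reg.L

/-- The algorithm: it locates the clauses, chooses the number of price levels, and runs the auction
and the searches. -/
def satProgram : Cmd :=
  .const Reg.one 1 ;;
  .loop (.lt Reg.k Reg.m) startsBody ;;
  .loop (.lt Reg.sq Reg.m) levelsBody ;;
  .loop (.lt Reg.i Reg.m) auctionBody ;;
  search

/-- Before the auction, its registers and arrays, and those of the search, are zero. -/
structure Blank (σ : State) : Prop where
  zero : σ.reg Reg.zero = 0
  one : σ.reg Reg.one = 1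
  i : σ.reg Reg.i = 0
  cur : σ.reg Reg.cur = 0
  f : σ.reg Reg.f = 0
  s : σ.reg Reg.s = 0
  level : σ.arr Arr.level = fun _ => 0
  price : σ.arr Arr.price = fun _ => 0
  owner : σ.arr Arr.owner = fun _ => 0
  free : σ.arr Arr.free = fun _ => 0
  visit : σ.arr Arr.visit = fun _ => 0

/-- The state after `k` clauses have been located. -/
structure StartsState (G : Incidence) (σ : State) (Φ : ℕ) : Prop extends Blank σ where
  m : σ.reg Reg.m = G.m
  L : σ.reg Reg.L = 0
  sq : σ.reg Reg.sq = 0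
  k_le : σ.reg Reg.k ≤ G.m
  pos : σ.reg Reg.pos = G.start (σ.reg Reg.k)
  len : ∀ j < G.m, G.start j + σ.arr Arr.len j = G.start (j + 1)
  var : σ.arr Arr.var = G.var
  start : σ.arr Arr.start = fun j => if j ≤ σ.reg Reg.k then G.start j else 0
  ptr : ∀ j < σ.reg Reg.k, σ.arr Arr.ptr j = G.start j
  pot : G.m - σ.reg Reg.k = Φ

theorem runs_startsBody {w : ℕ} {G : Incidence}
    (hw : G.start G.m + 4 * G.m + 4 ≤ 2 ^ w) {σ : State} {Φ : ℕ} (h : StartsState G σ Φ)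
    (hb : σ.reg Reg.k < σ.reg Reg.m) :
    Runs w startsBody σ 5 fun τ _ => ∃ Φ' < Φ, StartsState G τ Φ' := by
  obtain ⟨⟨h0, h1, hi, hcur, hf, hs0, hlev, hpr, hown, hfree, hvis⟩, hm, hL, hsq, hk, hpos, hlen,
    hv, hs, hp, rfl⟩ := h
  rw [hm] at hb
  have hE := G.start_le_total (u := σ.reg Reg.k + 1) hb
  have hlen' := hlen _ hb
  simp only [Reg.m, Reg.zero, Reg.one, Reg.k, Reg.pos, Reg.L, Reg.sq, Reg.i, Reg.cur, Reg.f,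
    Reg.s, Arr.len, Arr.var, Arr.start, Arr.ptr, Arr.level, Arr.price, Arr.owner, Arr.free,
    Arr.visit] at *
  refine .seq <| .load <| .seq <| .store <| .seq <| .add ?_ <| .seq <| .add ?_ <| .store ?_
  · simp [State.setReg, State.setArr]; omega
  · simp [State.setReg, State.setArr]; omega
  · refine ⟨G.m - (σ.reg 4 + 1), by omega, ⟨?_, ?_, ?_, ?_, ?_, ?_, ?_, ?_, ?_, ?_, ?_⟩, ?_, ?_,
      ?_, ?_, ?_, ?_, ?_, ?_, ?_, ?_⟩
    case refine_19 =>
      simp only [State.setReg, State.setArr, Arr.start, Reg.k, Reg.pos]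
      ext j
      simp [h1, hs, Function.update_apply]
      split_ifs with h1 h2 h2 <;> first | omega | grind
    case refine_20 =>
      intro j hj
      simp [State.setReg, State.setArr, h1, Function.update_apply] at hj ⊢
      split_ifs with h1
      · grind
      · exact hp j (by omega)
    all_goals simp [State.setReg, State.setArr, h0, h1, hi, hcur, hf, hs0, hlev, hpr, hown, hfree,
      hvis, hm, hL, hsq, hv]
    · omega
    · omega
    · exact hlen

/-- The state while the number of levels is raised to the square root of the number of clauses. -/
structure LevelsState (G : Incidence) (σ : State) (Φ : ℕ) : Prop extends Blank σ where
  m : σ.reg Reg.m = G.m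
  sq : σ.reg Reg.sq = σ.reg Reg.L * σ.reg Reg.L
  lt : (σ.reg Reg.L - 1) * (σ.reg Reg.L - 1) < G.m
  le : σ.reg Reg.L ≤ G.m
  var : σ.arr Arr.var = G.var
  start : σ.arr Arr.start = G.start
  ptr : ∀ j < G.m, σ.arr Arr.ptr j = G.start j
  pot : G.m - σ.reg Reg.sq = Φ

theorem runs_levelsBody {w : ℕ} {G : Incidence}
    (hw : G.start G.m + 4 * G.m + 4 ≤ 2 ^ w) {σ : State} {Φ : ℕ} (h : LevelsState G σ Φ)
    (hb : σ.reg Reg.sq < σ.reg Reg.m) :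
    Runs w levelsBody σ 3 fun τ _ => ∃ Φ' < Φ, LevelsState G τ Φ' := by
  obtain ⟨⟨h0, h1, hi, hcur, hf, hs0, hlev, hpr, hown, hfree, hvis⟩, hm, hsq, hlt, hle,
    hv, hs, hp, rfl⟩ := h
  rw [hm] at hb
  have hLL : σ.reg Reg.L ≤ σ.reg Reg.L * σ.reg Reg.L := Nat.le_mul_self _
  simp only [Reg.m, Reg.zero, Reg.one, Reg.L, Reg.sq, Reg.i, Reg.cur, Reg.f,
    Reg.s, Arr.var, Arr.start, Arr.ptr, Arr.level, Arr.price, Arr.owner, Arr.free,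
    Arr.visit] at *
  refine .seq <| .add ?_ <| .seq <| .add ?_ <| .add ?_ ?_
  · simp; omega
  · simp [State.setReg, h1]; omega
  · simp [State.setReg, h1]; omega
  · refine ⟨G.m - (σ.reg 7 + 1) * (σ.reg 7 + 1), ?_,
      ⟨?_, ?_, ?_, ?_, ?_, ?_, ?_, ?_, ?_, ?_, ?_⟩, ?_, ?_, ?_, ?_, ?_, ?_, ?_, ?_⟩
    case refine_1 => rw [add_mul, mul_add]; omega
    all_goals simp [State.setReg, h0, h1, hi, hcur, hf, hs0, hlev, hpr, hown, hfree,
      hvis, hm, hv, hs]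
    · rw [hsq]; ring
    · omega
    · omega
    · exact hp
    · rw [hsq]; congr 1; ring

theorem auctionState_of_levelsState {G : Incidence} {σ : State} {Φ : ℕ} (hm0 : 0 < G.m)
    (h : LevelsState G σ Φ) (hb : ¬ σ.reg Reg.sq < σ.reg Reg.m) :
    AuctionState G (Nat.sqrt (G.m - 1) + 1) σ
      ((Nat.sqrt (G.m - 1) + 1) * (G.start G.m + G.m)) := by
  obtain ⟨⟨h0, h1, hi, hcur, hf, hs0, hlev, hpr, hown, hfree, hvis⟩, hm, hsq, hlt, hle,
    hv, hs, hp, rfl⟩ := h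
  rw [hm, hsq, not_lt] at hb
  have hL0 : 0 < σ.reg Reg.L := Nat.pos_of_ne_zero fun e => by rw [e] at hb; omega
  have hL : σ.reg Reg.L - 1 = Nat.sqrt (G.m - 1) := by
    rw [Nat.eq_sqrt, Nat.sub_add_cancel hL0]
    omega
  refine ⟨⟨hm, h0, h1, by omega, hv, hs⟩, ?_, by omega, by omega, ?_, hs0, hvis⟩
  · rw [hi, hcur, hf, hlev, hpr, hown, hfree]
    exact .init G (Nat.succ_pos _) hp
  · rw [hlev, ← G.auctionPot_init]
    refine Finset.sum_congr rfl fun u hu => ?_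
    rw [hp u (Finset.mem_range.1 hu)]

/-- A machine whose words hold the numbers of the order of the size of the input decides in time
`O(E √m)` whether there is a system of distinct representatives. The number of price levels is the
square root of `m`, rounded up. -/
theorem runs_satProgram {w : ℕ} {G : Incidence} (hm0 : 0 < G.m) {σ : State}
    (hw : G.start G.m + 4 * G.m + 4 ≤ 2 ^ w) (h : StartsState G (σ.setReg Reg.one 1) G.m)
    (hG : ∀ j, G.m < j → G.start j = 0) {L : ℕ} (hL : L = Nat.sqrt (G.m - 1) + 1) :
    Runs w satProgram σ (10 + 26 * (L * (2 * G.start G.m + 1)) +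
      21 * (L * (G.start G.m + G.m)) + 1 + 4 * G.m + 1 + 6 * G.m + 1 + 1) fun τ _ =>
        (G.Saturable → τ.reg 0 = 1) ∧ (¬ G.Saturable → τ.reg 0 = 0) := by
  have hsq := Nat.sqrt_le (G.m - 1)
  have hsq' := Nat.lt_succ_sqrt (G.m - 1)
  have hle := Nat.sqrt_le_self (G.m - 1)
  refine .seq <| .const (by omega) <| .seq <|
    .loop (StartsState G) (fun _ _ => runs_startsBody hw) h fun τ Φ hτ hb => .seq <|
    .mono (.loop (LevelsState G) (fun _ _ => runs_levelsBody hw) (Φ := G.m - τ.reg Reg.sq) ?_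
      fun τ Φ hτ hb => .seq <| .loop (AuctionState G L)
        (fun _ _ => runs_auctionBody (by omega) hw)
        (hL ▸ auctionState_of_levelsState hm0 hτ hb)
        fun τ Φ hτ hb => runs_search (by omega) ?_ hm0 hw hτ hb) ?_
  · have hk : τ.reg Reg.k = G.m := by
      have hb' : ¬ τ.reg Reg.k < τ.reg Reg.m := hb
      rw [hτ.m] at hb'
      exact le_antisymm hτ.k_le (not_lt.1 hb')
    refine ⟨hτ.toBlank, hτ.m, by rw [hτ.sq, hτ.L], by rw [hτ.L]; omega, by rw [hτ.L]; omega,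
      hτ.var, ?_, hk ▸ hτ.ptr, rfl⟩
    rw [hτ.start, hk]
    ext j
    by_cases hj : j ≤ G.m
    · exact if_pos hj
    · rw [if_neg hj, hG j (not_le.1 hj)]
  · rw [hL]
    simp only [Nat.succ_eq_add_one] at hsq'
    omega
  · have : 4 * (G.m - τ.reg Reg.sq) ≤ 4 * G.m := Nat.mul_le_mul_left _ (by omega)
    omega

end WordRAM

/-! ### Polynomials and the memory of the machine -/

namespace PiSigma

variable {m s n : ℕ}

/-- The clauses of `p`, stored as in the memory of the machine. -/
def incidence (p : PiSigma m s n) : Incidence where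
  m := m
  start u := if u ≤ m then ∑ j ∈ Finset.range u, (List.ofFn fun k => (p.clause k).length).getD j 0
    else 0
  var e := (((List.ofFn p.clause).flatten).map Fin.val).getD e 0
  start_zero := by simp
  start_le u hu := by
    rw [if_pos hu.le, if_pos (Nat.succ_le_of_lt hu), Finset.sum_range_succ]
    omega

theorem incidence_start_succ (p : PiSigma m s n) {u : ℕ} (hu : u < m) :
    p.incidence.start (u + 1) = p.incidence.start u + (p.clause ⟨u, hu⟩).length := by
  simp only [incidence]
  rw [if_pos hu.le, if_pos (Nat.succ_le_of_lt hu), Finset.sum_range_succ]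
  simp [List.getD_eq_getElem?_getD, hu]

theorem incidence_start_eq (p : PiSigma m s n) {u : ℕ} (hu : u ≤ m) :
    p.incidence.start u = (((List.ofFn p.clause).map List.length).take u).sum := by
  induction u with
  | zero => simp [incidence]
  | succ u ih =>
    rw [p.incidence_start_succ hu, ih (by omega), List.sum_take_succ _ _ (by simpa using hu)]
    simp

theorem incidence_start_total (p : PiSigma m s n) : p.incidence.start m = p.numTerms := by
  rw [p.incidence_start_eq le_rfl, List.take_of_length_le (by simp), List.map_ofFn, List.sum_ofFn]
  rfl

theorem incidence_var (p : PiSigma m s n) {u : ℕ} (hu : u < m) {j : ℕ}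
    (hj : j < (p.clause ⟨u, hu⟩).length) :
    p.incidence.var (p.incidence.start u + j) = (p.clause ⟨u, hu⟩)[j] := by
  have h : (List.ofFn p.clause).flatten.drop (p.incidence.start u) =
      p.clause ⟨u, hu⟩ ++ ((List.ofFn p.clause).drop (u + 1)).flatten := by
    rw [p.incidence_start_eq hu.le, List.drop_sum_flatten,
      List.drop_eq_getElem_cons (by simpa using hu), List.flatten_cons]
    simp
  have h' : (List.ofFn p.clause).flatten[p.incidence.start u + j]? =
      some (p.clause ⟨u, hu⟩)[j] := by
    rw [← List.getElem?_drop, h, List.getElem?_append_left hj, List.getElem?_eq_getElem hj]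
  change (((List.ofFn p.clause).flatten).map Fin.val).getD _ 0 = _
  rw [List.getD_eq_getElem?_getD, List.getElem?_map, h']
  rfl

theorem incidence_adj (p : PiSigma m s n) {u : ℕ} (hu : u < m) {v : ℕ} :
    p.incidence.Adj u v ↔ ∃ x ∈ p.clause ⟨u, hu⟩, x.val = v := by
  have hs := p.incidence_start_succ hu
  constructor
  · rintro ⟨e, h1, h2, rfl⟩
    obtain ⟨j, rfl⟩ := Nat.exists_eq_add_of_le h1
    have hj : j < (p.clause ⟨u, hu⟩).length := by omega
    exact ⟨_, List.getElem_mem hj, (p.incidence_var hu hj).symm⟩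
  · rintro ⟨x, hx, rfl⟩
    obtain ⟨j, hj, rfl⟩ := List.getElem_of_mem hx
    exact ⟨_, by omega, by omega, p.incidence_var hu hj⟩

/-- A choice of terms yields a multilinear monomial if and only if it chooses distinct variables. -/
theorem saturable_incidence (p : PiSigma m s n) :
    p.incidence.Saturable ↔ p.HasMultilinearMonomial := by
  have hd : ∀ (c : ∀ i : Fin m, Fin (p.clause i).length) (v : Fin n),
      (∑ i, Finsupp.single ((p.clause i).get (c i)) 1 : Fin n →₀ ℕ) v =
        (Finset.univ.filter fun i => (p.clause i).get (c i) = v).card := by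
    intro c v
    rw [Finsupp.finsetSum_apply, Finset.card_filter]
    exact Finset.sum_congr rfl fun i _ => Finsupp.single_apply
  unfold HasMultilinearMonomial expansion IsMultilinear
  simp only [Multiset.mem_map, Finset.mem_val, Finset.mem_univ, true_and, exists_exists_eq_and, hd,
    Finset.card_le_one, Finset.mem_filter]
  constructor
  · rintro ⟨g, hadj, hinj⟩
    have h : ∀ i : Fin m, ∃ c : Fin (p.clause i).length, ((p.clause i).get c).val = g i := by
      intro i
      obtain ⟨x, hx, hxv⟩ := (p.incidence_adj i.2).1 (hadj i i.2)
      obtain ⟨c, hc⟩ := List.get_of_mem hx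
      exact ⟨c, by rw [hc, hxv]⟩
    choose c hc using h
    refine ⟨c, fun v i hi j hj => Fin.ext (hinj i.2 j.2 ?_)⟩
    rw [← hc, ← hc, hi, hj]
  · rintro ⟨c, hc⟩
    refine ⟨fun u => if hu : u < m then (p.clause ⟨u, hu⟩).get (c ⟨u, hu⟩) else 0,
      fun u hu => ?_, fun u hu u' hu' e => ?_⟩
    · rw [p.incidence_adj hu]
      exact ⟨_, List.get_mem _ (c ⟨u, hu⟩), by simp [show u < m from hu]⟩
    · have hu : u < m := hu
      have hu' : u' < m := hu'
      simp only [hu, hu', dif_pos] at e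
      exact congrArg Fin.val (hc _ ⟨u, hu⟩ rfl ⟨u', hu'⟩ (Fin.ext e).symm)

/-- Over the integers, the monomials of the expansion do not cancel. -/
theorem mem_support_toMvPolynomial (p : PiSigma m s n) (d : Fin n →₀ ℕ) :
    d ∈ (p.toMvPolynomial ℤ).support ↔ d ∈ p.expansion := by
  classical
  have h : (p.toMvPolynomial ℤ).coeff d = (p.expansion.count d : ℤ) := by
    rw [p.toMvPolynomial_eq_sum_expansion ℤ]
    induction p.expansion using Multiset.induction_on with
    | empty => simp
    | cons a t ih =>
      rw [Multiset.map_cons, Multiset.sum_cons, MvPolynomial.coeff_add, ih,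
        MvPolynomial.coeff_monomial, Multiset.count_cons]
      by_cases had : a = d
      · subst had
        simp [add_comm]
      · simp [had, Ne.symm had]
  rw [MvPolynomial.mem_support_iff, h, Nat.cast_ne_zero, Multiset.count_ne_zero]

theorem incidence_start_of_lt (p : PiSigma m s n) (u : ℕ) (hu : m < u) :
    p.incidence.start u = 0 :=
  if_neg hu.not_ge

theorem startsState_input (p : PiSigma m s n) :
    WordRAM.StartsState p.incidence (p.input.setReg WordRAM.Reg.one 1) m := by
  refine ⟨⟨?_, ?_, ?_, ?_, ?_, ?_, ?_, ?_, ?_, ?_, ?_⟩, ?_, ?_, ?_, ?_, ?_, ?_, ?_, ?_, ?_, ?_⟩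
  case refine_17 =>
    intro j hj
    rw [p.incidence_start_succ hj]
    simp [WordRAM.State.setReg, input, List.getD_eq_getElem?_getD, show j < m from hj]
  case refine_19 =>
    ext j
    simp only [WordRAM.State.setReg, input, WordRAM.Reg.one, WordRAM.Reg.k, WordRAM.Arr.start]
    simp
    rintro rfl
    exact p.incidence.start_zero.symm
  all_goals simp [WordRAM.State.setReg, input, incidence]

/-- The steps of the loops amount to `O(E L)`, where `E` is the number of terms. -/
theorem time_le {m s n E L t : ℕ} (hm : 1 ≤ m) (hmE : m ≤ E) (hE : E ≤ m * s)
    (hL : L = Nat.sqrt (m - 1) + 1)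
    (ht : t ≤ 10 + 26 * (L * (2 * E + 1)) + 21 * (L * (E + m)) + 1 + 4 * m + 1 + 6 * m + 1 + 1) :
    (t : ℝ) ≤ 400 * ((m : ℝ) * (s : ℝ) * Real.sqrt ((m : ℝ) + (n : ℝ))) := by
  have hL1 : 1 ≤ L := by omega
  have h1 : t ≤ 200 * (L * E) := by nlinarith
  have h2 : (L : ℝ) ≤ 2 * Real.sqrt ((m : ℝ) + (n : ℝ)) := by
    have h3 : L - 1 ≤ Nat.sqrt m := by rw [hL]; exact Nat.sqrt_le_sqrt (by omega)
    have h4 : (Nat.sqrt m : ℝ) ≤ Real.sqrt m := Real.nat_sqrt_le_real_sqrt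
    have h5 : Real.sqrt m ≤ Real.sqrt ((m : ℝ) + (n : ℝ)) := Real.sqrt_le_sqrt (by simp)
    have h6 : (1 : ℝ) ≤ Real.sqrt m := Real.one_le_sqrt.2 (by exact_mod_cast hm)
    have h7 : (L : ℝ) ≤ Nat.sqrt m + 1 := by exact_mod_cast (by omega : L ≤ Nat.sqrt m + 1)
    linarith
  calc (t : ℝ) ≤ 200 * (L * E) := by exact_mod_cast h1
    _ ≤ 200 * ((2 * Real.sqrt ((m : ℝ) + (n : ℝ))) * (m * s)) := by
      gcongr
      exact_mod_cast hE
    _ = _ := by ring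

end PiSigma

theorem mainTheorem4 :
    ∃ (prog : WordRAM.Cmd) (C : ℝ) (K : ℕ),
      ∀ (m s n : ℕ), 1 ≤ m → 1 ≤ s → ∀ p : PiSigma m s n,
        (∀ w : ℕ, K * (n + p.numTerms) ≤ 2 ^ w →
          ∃ (t : ℕ) (τ : WordRAM.State),
            WordRAM.Exec w prog p.input t τ ∧
            (t : ℝ) ≤ C * ((m : ℝ) * (s : ℝ) * Real.sqrt ((m : ℝ) + (n : ℝ))) ∧
            (p.HasMultilinearMonomial → τ.reg 0 = 1) ∧
            (¬ p.HasMultilinearMonomial → τ.reg 0 = 0)) ∧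
        (p.HasMultilinearMonomial ↔
          ∃ d ∈ (p.toMvPolynomial ℤ).support, IsMultilinear d) := by
  refine ⟨WordRAM.satProgram, 400, 9, fun m s n hm _ p => ⟨fun w hw => ?_, ?_⟩⟩
  · have hmE : m ≤ p.numTerms := by
      simpa [PiSigma.numTerms] using
        Finset.card_nsmul_le_sum Finset.univ (fun i => (p.clause i).length) 1
          fun i _ => p.one_le_length i
    have hE : p.numTerms ≤ m * s := by
      simpa [PiSigma.numTerms] using
        Finset.sum_le_card_nsmul Finset.univ (fun i => (p.clause i).length) s
          fun i _ => p.length_le i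
    have htot := p.incidence_start_total
    have hm' : p.incidence.m = m := rfl
    obtain ⟨t, τ, k, hexec, ht, hτ⟩ := WordRAM.runs_satProgram (w := w) (G := p.incidence) hm
      (by rw [hm', htot]; omega) p.startsState_input p.incidence_start_of_lt rfl
    rw [p.saturable_incidence] at hτ
    rw [hm', htot] at ht
    exact ⟨t, τ, hexec, PiSigma.time_le hm hmE hE rfl ((Nat.le_add_right t k).trans ht), hτ⟩
  · simp only [PiSigma.HasMultilinearMonomial, p.mem_support_toMvPolynomial]
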